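/- **Definitions.** Systems are finite-dimensional with fixed orthonormal bases; $\mathbf t$ denotes transposition in such a basis; an *operation* is a completely positive trace-preserving linear map. Let $|\phi\rangle=K^{-1/2}\sum_i|i\rangle|i\rangle$ and $\phi=|\phi\rangle\langle\phi|$. For an integer $d\ge 2$ and $\alpha\in[0,1]$, the generalised Werner–Holevo channel on a $d$-dimensional system is $$\mathcal W^{(d,\alpha)}(X)=(1-\alpha)\,\frac{\mathbb 1\,\mathrm{Tr}X+X^{\mathrm T}}{d+1}+\alpha\,\frac{\mathbb 1\,\mathrm{Tr}X-X^{\mathrm T}}{d-1}.$$ A *forward-assisted code of size $K$* for a channel $\mathcal N_{B\leftarrow A'}$ consists of arbitrary finite-dimensional systems $Q,R$ and operations $\mathcal E_{A'Q\leftarrow A}$ (encoder), $\mathcal F_{R\leftarrow Q}$ (side channel), $\mathcal D_{B'\leftarrow BR}$ (decoder), where $\dim A=\dim B'=K$. It yields the operation $\mathcal M_{B'\leftarrow A}=\mathcal D(\mathcal N\otimes\mathcal F)\mathcal E$, whose *channel fidelity* is $\mathrm{Tr}\,\phi_{B'\tilde A}\,(\mathcal M_{B'\leftarrow A}\otimes\mathrm{id}_{\tilde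 A})(\phi_{A\tilde A})$, and it determines the bipartite operation $\mathcal Z_{A'B'\leftarrow AB}=\mathcal D\mathcal F\mathcal E$, with Alice holding $A,A'$ and Bob holding $B,B'$. The code is * *non-signalling* (NS) if $\mathrm{Tr}_{A'}\mathcal Z=\mathcal Z^{\mathrm{Bob}}_{B'\leftarrow B}\mathrm{Tr}_A$ for some operation $\mathcal Z^{\mathrm{Bob}}$; * *PPT-preserving* (PPTp) if, for all finite-dimensional ancillas $\tilde A$ of Alice and $\tilde B$ of Bob and every state $\rho_{A\tilde AB\tilde B}$, $\mathbf t_{B\tilde B}\rho\ge 0$ implies $\mathbf t_{B'\tilde B}\big[(\mathcal Z\otimes \mathrm{id}_{\tilde A\tilde B})\rho\big]\ge 0$. For $0\le i,j\le n$ put $$g^{(n)}_j=2^{-n}\binom nj(d+1)^{n-j}(d-1)^j,\qquad M^{(n)}_{ij}=2^{-n}\sum_{k=0}^{\min\{i,j\}}\binom{n-i}{j-k}\binom ik(1+d)^{i-k}(1-d)^k .$$ **Proposition.** Let $d\ge2$, $\alpha\in[0,1]$, $n\ge0$, $K\ge1$ ($d,n,K$ integers). Consider forward-assisted codes of size $K$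 for $n$ uses $(\mathcal W^{(d,\alpha)})^{\otimes n}$ of the channel, either all of them, or only the NS ones, or only the PPTp ones, or only those that are both NS and PPTp. In each of the four cases the maximum channel fidelity over these codes is attained, and it equals the (attained) maximum of the linear program in $n+1$ real variables $x_0,\dots,x_n$ $$\max\; d^n\sum_{j=0}^n\binom nj(1-\alpha)^{n-j}\alpha^j x_j\quad\text{subject to}\quad 0\le x_i\le d^{-n}\ \ (i=0,\dots,n),$$ with the additional constraint $$\mathbf{NS}:\ \sum_{j=0}^n g^{(n)}_jx_j=\frac1{K^2}$$ if the codes are required to be NS, and the additional constraints $$\mathbf{PPTp}:\ -\frac{d^{-n}}K\le\sum_{j=0}^nM^{(n)}_{ij}x_j\le\frac{d^{-n}}K\qquad(i=0,\dots,n)$$ if the codes are required to be PPTp. -/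

import Mathlib

open scoped ComplexOrder

namespace QCode

noncomputable section

/-! ### Systems, operators and operations

A finite dimensional quantum system is a finite type labelling its computational basis; operators
on it are complex square matrices; composite systems are product types. -/

/-- Linear maps from operators on the system `q` to operators on the system `r`. -/
abbrev SuperOp (q r : Type) : Type := Matrix q q ℂ →ₗ[ℂ] Matrix r r ℂ

/-- `N ⊗ id`: the map `N` acting on the first factor, the system `a` being left alone. -/
def actFst {q r : Type} (N : SuperOp q r) (a : Type) : SuperOp (q × a) (r × a) where
  toFun X := Matrix.of fun s t => N (Matrix.of fun i j => X (i, s.2) (j, t.2)) s.1 t.1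
  map_add' X Y := by
    ext s t
    exact congrFun (congrFun (map_add N (Matrix.of fun i j => X (i, s.2) (j, t.2))
      (Matrix.of fun i j => Y (i, s.2) (j, t.2))) s.1) t.1
  map_smul' c X := by
    ext s t
    exact congrFun (congrFun (map_smul N c (Matrix.of fun i j => X (i, s.2) (j, t.2))) s.1) t.1

/-- `id ⊗ N`: the map `N` acting on the second factor, the system `a` being left alone. -/
def actSnd {q r : Type} (a : Type) (N : SuperOp q r) : SuperOp (a × q) (a × r) where
  toFun X := Matrix.of fun s t => N (Matrix.of fun i j => X (s.1, i) (t.1, j)) s.2 t.2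
  map_add' X Y := by
    ext s t
    exact congrFun (congrFun (map_add N (Matrix.of fun i j => X (s.1, i) (t.1, j))
      (Matrix.of fun i j => Y (s.1, i) (t.1, j))) s.2) t.2
  map_smul' c X := by
    ext s t
    exact congrFun (congrFun (map_smul N c (Matrix.of fun i j => X (s.1, i) (t.1, j))) s.2) t.2

/-- Relabelling of the basis of a system, used only to reorder tensor factors. -/
def relabel {q r : Type} (e : q ≃ r) : SuperOp q r :=
  (Matrix.reindexLinearEquiv ℂ ℂ e e).toLinearMap

/-- Complete positivity: `N ⊗ id` preserves positive semidefiniteness for every finite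
dimensional ancilla. -/
def IsCompletelyPositive {q r : Type} (N : SuperOp q r) : Prop :=
  ∀ (k : ℕ) (X : Matrix (q × Fin k) (q × Fin k) ℂ),
    X.PosSemidef → (actFst N (Fin k) X).PosSemidef

/-- Preservation of the trace. -/
def IsTracePreserving {q r : Type} [Fintype q] [Fintype r] (N : SuperOp q r) : Prop :=
  ∀ X : Matrix q q ℂ, (N X).trace = X.trace

/-- An operation (channel): a completely positive trace preserving linear map. -/
def IsOperation {q r : Type} [Fintype q] [Fintype r] (N : SuperOp q r) : Prop :=
  IsCompletelyPositive N ∧ IsTracePreserving N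

/-- A state (density operator). -/
def IsState {q : Type} [Fintype q] (ρ : Matrix q q ℂ) : Prop :=
  ρ.PosSemidef ∧ ρ.trace = 1

/-- The partial trace over the first factor. -/
def traceFst (a b : Type) [Fintype a] : SuperOp (a × b) b where
  toFun X := Matrix.of fun s t => ∑ i, X (i, s) (i, t)
  map_add' X Y := by
    ext s t
    simp [Finset.sum_add_distrib]
  map_smul' c X := by
    ext s t
    simp [Finset.mul_sum]

/-- The maximally entangled unit vector `|φ⟩ = (dim q)^{-1/2} ∑ᵢ |i⟩|i⟩` of two copies of `q`. -/
def maxEntVec (q : Type) [Fintype q] [DecidableEq q] : q × q → ℂ :=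
  fun p => if p.1 = p.2 then ((Real.sqrt (Fintype.card q))⁻¹ : ℝ) else 0

/-- The maximally entangled state `φ = |φ⟩⟨φ|`. -/
def maxEnt (q : Type) [Fintype q] [DecidableEq q] : Matrix (q × q) (q × q) ℂ :=
  Matrix.vecMulVec (maxEntVec q) (star (maxEntVec q))

/-- The channel fidelity `Tr φ (M ⊗ id) φ` of an operation from a system to a copy of itself. The
real part only changes the type: for an operation `M` the trace is a nonnegative real. -/
def channelFidelity {q : Type} [Fintype q] [DecidableEq q] (M : SuperOp q q) : ℝ :=
  (maxEnt q * actFst M q (maxEnt q)).trace.re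

/-- The `n`-fold tensor power of a linear map between operator spaces, given by
`⊗ᵢ |fᵢ⟩⟨gᵢ| ↦ ⊗ᵢ N(|fᵢ⟩⟨gᵢ|)`. The `n`-fold tensor power of the system `q` is
labelled by `Fin n → q`. -/
def tensorPow {q r : Type} [Fintype q] [DecidableEq q] (N : SuperOp q r) (n : ℕ) :
    SuperOp (Fin n → q) (Fin n → r) where
  toFun X := Matrix.of fun s t =>
    ∑ f : Fin n → q, ∑ g : Fin n → q,
      X f g * ∏ i, N (Matrix.single (f i) (g i) 1) (s i) (t i)
  map_add' X Y := by
    ext s t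
    simp [add_mul, Finset.sum_add_distrib]
  map_smul' c X := by
    ext s t
    simp [Finset.mul_sum, mul_assoc]

/-! ### Forward-assisted codes -/

/-- A forward-assisted code of size `K` for channels with input system `a'` and output system `b`:
an encoder from `A` to `A' Q`, a side channel from `Q` to `R` with arbitrary finite
dimensional systems `Q`, `R`, and a decoder from `B R` to `B'`, where
`dim A = dim B' = K`. -/
structure ForwardAssistedCode (a' b : Type) [Fintype a'] [Fintype b] (K : ℕ) where
  Q : Type
  R : Type
  [fintypeQ : Fintype Q]
  [fintypeR : Fintype R]
  enc : SuperOp (Fin K) (a' × Q)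
  side : SuperOp Q R
  dec : SuperOp (b × R) (Fin K)
  enc_isOperation : IsOperation enc
  side_isOperation : IsOperation side
  dec_isOperation : IsOperation dec

namespace ForwardAssistedCode

variable {a' b : Type} [Fintype a'] [Fintype b] {K : ℕ}

/-- The operation from `A` to `B'` that results from using the code with the channel `N`. -/
def applyTo (C : ForwardAssistedCode a' b K) (N : SuperOp a' b) : SuperOp (Fin K) (Fin K) :=
  C.dec ∘ₗ actFst N C.R ∘ₗ actSnd a' C.side ∘ₗ C.enc

/-- The bipartite operation `Z` of the code, obtained by leaving out the channel: Alice's input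
is `A` and her output `A'`; Bob's input is `B` and his output `B'`. -/
def bipartite (C : ForwardAssistedCode a' b K) : SuperOp (Fin K × b) (a' × Fin K) :=
  actSnd a' (C.dec ∘ₗ actSnd b C.side) ∘ₗ
    relabel ((Equiv.prodAssoc a' C.Q b).trans
      (Equiv.prodCongr (Equiv.refl a') (Equiv.prodComm C.Q b))) ∘ₗ
    actFst C.enc b

end ForwardAssistedCode

/-- Alice's input `a` and output `a'`, Bob's input `b` and output `b'`: the bipartite map `Z` is
non-signalling from Alice to Bob if Bob's marginal output is obtained from Bob's marginal input by
some fixed operation. -/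
def NonSignallingAliceToBob {a b a' b' : Type} [Fintype a] [Fintype b] [Fintype a'] [Fintype b']
    (Z : SuperOp (a × b) (a' × b')) : Prop :=
  ∃ ZBob : SuperOp b b', IsOperation ZBob ∧ traceFst a' b' ∘ₗ Z = ZBob ∘ₗ traceFst a b

/-- Transposition of Bob's systems `b` and `bt` in an operator on `(a b)(at bt)`. -/
def bobTranspose {a b at' bt : Type}
    (X : Matrix ((a × b) × (at' × bt)) ((a × b) × (at' × bt)) ℂ) :
    Matrix ((a × b) × (at' × bt)) ((a × b) × (at' × bt)) ℂ :=
  Matrix.of fun s t =>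
    X ((s.1.1, t.1.2), (s.2.1, t.2.2)) ((t.1.1, s.1.2), (t.2.1, s.2.2))

/-- The bipartite map `Z` is PPT-preserving: for all ancillas in the possession of Alice (`at'`)
and Bob (`bt`), it takes every state that is PPT with respect to the partition Alice / Bob to a
PPT operator. -/
def PPTPreserving {a b a' b' : Type} [Fintype a] [Fintype b]
    (Z : SuperOp (a × b) (a' × b')) : Prop :=
  ∀ (at' bt : Type) [Fintype at'] [Fintype bt]
    (ρ : Matrix ((a × b) × (at' × bt)) ((a × b) × (at' × bt)) ℂ),
    IsState ρ → (bobTranspose ρ).PosSemidef →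
      (bobTranspose (actFst Z (at' × bt) ρ)).PosSemidef

/-- The channel fidelities that can be reached with the channel `N` by forward-assisted codes of
size `K` which are non-signalling (required if `ns` holds) and PPT-preserving (required if `ppt`
holds). -/
def achievableFidelities {a' b : Type} [Fintype a'] [Fintype b] (N : SuperOp a' b) (K : ℕ)
    (ns ppt : Prop) : Set ℝ :=
  {f | ∃ C : ForwardAssistedCode a' b K,
    (ns → NonSignallingAliceToBob C.bipartite) ∧ (ppt → PPTPreserving C.bipartite) ∧
      f = channelFidelity (C.applyTo N)}

/-! ### Generalised Werner-Holevo channels -/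

/-- `X ↦ (1 Tr X + Xᵀ) / (d + 1)`. -/
def wernerHolevoZero (d : ℕ) : SuperOp (Fin d) (Fin d) where
  toFun X := ((d : ℂ) + 1)⁻¹ • (X.trace • (1 : Matrix (Fin d) (Fin d) ℂ) + X.transpose)
  map_add' X Y := by
    simp only [Matrix.trace_add, Matrix.transpose_add, add_smul, smul_add]
    abel
  map_smul' c X := by
    simp only [Matrix.trace_smul, Matrix.transpose_smul, smul_add, smul_smul, smul_eq_mul,
      RingHom.id_apply]
    congr 2 <;> ring

/-- `X ↦ (1 Tr X - Xᵀ) / (d - 1)`, the Werner-Holevo channel. -/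
def wernerHolevoOne (d : ℕ) : SuperOp (Fin d) (Fin d) where
  toFun X := ((d : ℂ) - 1)⁻¹ • (X.trace • (1 : Matrix (Fin d) (Fin d) ℂ) - X.transpose)
  map_add' X Y := by
    simp only [Matrix.trace_add, Matrix.transpose_add, add_smul, smul_add, smul_sub]
    abel
  map_smul' c X := by
    simp only [Matrix.trace_smul, Matrix.transpose_smul, smul_sub, smul_smul, smul_eq_mul,
      RingHom.id_apply]
    congr 2 <;> ring

/-- The generalised Werner-Holevo channel with parameter `α`. -/
def wernerHolevo (d : ℕ) (α : ℝ) : SuperOp (Fin d) (Fin d) :=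
  ((1 - α : ℝ) : ℂ) • wernerHolevoZero d + (α : ℂ) • wernerHolevoOne d

/-! ### The linear program -/

/-- `M_{ij} = 2^{-n} ∑_{k=0}^{min(i,j)} C(n-i, j-k) C(i, k) (1+d)^{i-k} (1-d)^k`. -/
def lpM (d n i j : ℕ) : ℝ :=
  ((2 : ℝ) ^ n)⁻¹ * ∑ k ∈ Finset.range (min i j + 1),
    ((n - i).choose (j - k) : ℝ) * (i.choose k : ℝ) * (1 + (d : ℝ)) ^ (i - k) *
      (1 - (d : ℝ)) ^ k

/-- `g_j = 2^{-n} C(n, j) (d+1)^{n-j} (d-1)^j`. -/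
def lpG (d n j : ℕ) : ℝ :=
  ((2 : ℝ) ^ n)⁻¹ * (n.choose j : ℝ) * ((d : ℝ) + 1) ^ (n - j) * ((d : ℝ) - 1) ^ j

/-- The objective `d^n ∑_j C(n, j) (1-α)^{n-j} α^j x_j`. -/
def lpObjective (d n : ℕ) (α : ℝ) (x : Fin (n + 1) → ℝ) : ℝ :=
  (d : ℝ) ^ n *
    ∑ j : Fin (n + 1), (n.choose j : ℝ) * (1 - α) ^ (n - (j : ℕ)) * α ^ (j : ℕ) * x j

/-- The feasible points of the linear program: the NS constraint is imposed if `ns` holds and the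
PPT constraints are imposed if `ppt` holds. -/
def lpFeasible (d n K : ℕ) (ns ppt : Prop) : Set (Fin (n + 1) → ℝ) :=
  {x | (∀ i, 0 ≤ x i ∧ x i ≤ ((d : ℝ) ^ n)⁻¹) ∧
    (ns → ∑ j : Fin (n + 1), lpG d n j * x j = 1 / (K : ℝ) ^ 2) ∧
    (ppt → ∀ i : Fin (n + 1),
      -(((d : ℝ) ^ n)⁻¹ / K) ≤ ∑ j : Fin (n + 1), lpM d n i j * x j ∧
        ∑ j : Fin (n + 1), lpM d n i j * x j ≤ ((d : ℝ) ^ n)⁻¹ / K)}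

end

end QCode

/-! The channel fidelity of a code is linear in the map it is used with, and makes sense for maps
that are not channels. A code is therefore recorded by its fidelities $f(s)$ with the products
$W_{s_1}\otimes\dots\otimes W_{s_n}$ of the two extreme channels, $s\in\{0,1\}^n$. Since $\mathcal
W^{\otimes n}$ is permutation invariant, only the averages $y_j$ of $f$ over the strings of weight
$j$ matter, and $x_j=d^{-n}y_j$.

Upper bound (`achievable_subset_lpObjective_image`): each constraint is the fidelity with a test map
in the span of these products. The products themselves are channels, so $0\le y_j\le1$. The tensor
power of $X\mapsto\mathbb 1\,\mathrm{Tr}X$ has the coefficients $g_j$, and every NS code gives it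
fidelity $d^n/K^2$. Products of the transposed identity and the transposed `complMap` have the
coefficients $M_{ij}$, and a PPTp code used with such a map has fidelity at most $1/K$ in absolute
value.

Lower bound (`lpObjective_mem_achievableFidelities`): `measurementCode` measures the effect
$L=\sum_s d^nx_{|s|}\bigotimes_iP_{s_i}$, with $P_0,P_1$ the symmetric and antisymmetric
projections. Its fidelity is the objective. The constraints on $x$ say that $0\le L\le1$, that the
marginal of $L$ is $d^nK^{-2}\mathbb 1$, and that $\pm K L^\Gamma\le1$ for the partial transpose
$L^\Gamma$; this makes the code valid, NS and PPTp respectively.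

The feasible set is compact and nonempty, so the maximum exists. For $K=1$ the identity has no
complement, but then $x_j=d^{-n}$ is feasible and optimal, and $L=1$. -/

namespace QCode

noncomputable section

open Matrix Finset

/-! ### Positive semidefinite matrices and their contractions -/

section Positivity

variable {c e k m : Type} [Fintype c]

theorem posSemidef_sum_block [Fintype m] {Y : Matrix (c × m) (c × m) ℂ} (hY : Y.PosSemidef) :
    (Matrix.of fun s t => ∑ i, ∑ j, Y (i, s) (j, t) : Matrix m m ℂ).PosSemidef := by
  classical
  convert hY.conjTranspose_mul_mul_same
    (Matrix.of fun (p : c × m) (s : m) => if p.2 = s then (1 : ℂ) else 0) using 1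
  ext s t
  simp only [Matrix.mul_apply, Matrix.conjTranspose_apply, Matrix.of_apply, Fintype.sum_prod_type,
    apply_ite star, star_one, star_zero, ite_mul, one_mul, zero_mul, mul_ite, mul_one, mul_zero,
    Finset.sum_ite_eq', Finset.mem_univ, if_true]
  rw [Finset.sum_comm]

/-- The contraction of two operators along a common factor. -/
def link (J : Matrix (c × e) (c × e) ℂ) (X : Matrix (c × k) (c × k) ℂ) :
    Matrix (e × k) (e × k) ℂ :=
  Matrix.of fun s t => ∑ i, ∑ j, J (i, s.1) (j, t.1) * X (i, s.2) (j, t.2)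

/-- By the Schur product theorem, after both operators are pulled back to the common index set;
summing over the blocks is a compression. Every complete positivity proof from an explicit kernel
goes through this. -/
theorem link_posSemidef [Fintype e] [Fintype k] {J : Matrix (c × e) (c × e) ℂ}
    {X : Matrix (c × k) (c × k) ℂ} (hJ : J.PosSemidef) (hX : X.PosSemidef) :
    (link J X).PosSemidef := by
  have h1 := hJ.submatrix fun p : c × (e × k) => (p.1, p.2.1)
  have h2 := hX.submatrix fun p : c × (e × k) => (p.1, p.2.2)
  have h3 := posSemidef_sum_block (h1.hadamard h2)
  simp only [Matrix.hadamard_apply, Matrix.submatrix_apply] at h3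
  exact h3

theorem trace_mul_re_nonneg [Fintype m] {A B : Matrix m m ℂ} (hA : A.PosSemidef)
    (hB : B.PosSemidef) : 0 ≤ (A * B).trace.re := by
  classical
  obtain ⟨k, v, rfl⟩ := Matrix.posSemidef_iff_eq_sum_vecMulVec.mp hA
  rw [Finset.sum_mul, Matrix.trace_sum, Complex.re_sum]
  refine Finset.sum_nonneg fun i _ => ?_
  rw [Matrix.vecMulVec_mul, Matrix.trace_vecMulVec, dotProduct_comm, ← Matrix.dotProduct_mulVec]
  exact (Complex.le_def.mp (hB.dotProduct_mulVec_nonneg (v i))).1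

theorem posSemidef_of_idempotent [Fintype m] {P : Matrix m m ℂ} (h1 : Pᴴ = P) (h2 : P * P = P) :
    P.PosSemidef := by
  have := Matrix.posSemidef_conjTranspose_mul_self P
  rwa [h1, h2] at this

end Positivity

/-! ### Closure properties of operations -/

section CompletePositivity

variable {q r u : Type}

theorem IsCompletelyPositive.posSemidef {N : SuperOp q r} (h : IsCompletelyPositive N) (k : Type)
    [Fintype k] {X : Matrix (q × k) (q × k) ℂ} (hX : X.PosSemidef) :
    (actFst N k X).PosSemidef := by
  have := h (Fintype.card k)
    (X.submatrix (Prod.map id (Fintype.equivFin k).symm) (Prod.map id (Fintype.equivFin k).symm))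
    (hX.submatrix _)
  convert this.submatrix (Prod.map id (Fintype.equivFin k)) using 1
  ext s t
  simp [actFst]

theorem IsCompletelyPositive.comp {N : SuperOp q r} {M : SuperOp r u}
    (hM : IsCompletelyPositive M) (hN : IsCompletelyPositive N) :
    IsCompletelyPositive (M ∘ₗ N) :=
  fun k _ hX => hM k _ (hN k _ hX)

theorem IsCompletelyPositive.add {N M : SuperOp q r}
    (hM : IsCompletelyPositive M) (hN : IsCompletelyPositive N) :
    IsCompletelyPositive (M + N) :=
  fun k _ hX => (hM k _ hX).add (hN k _ hX)

theorem IsCompletelyPositive.smul {N : SuperOp q r} (hN : IsCompletelyPositive N) {a : ℝ}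
    (ha : 0 ≤ a) : IsCompletelyPositive ((a : ℂ) • N) :=
  fun k _ hX => (hN k _ hX).smul (a := (a : ℂ)) (by exact_mod_cast ha)

theorem IsCompletelyPositive.actFst {N : SuperOp q r} (hN : IsCompletelyPositive N) (a : Type)
    [Fintype a] : IsCompletelyPositive (actFst N a) := fun k _ hX =>
  (hN.posSemidef (a × Fin k) (hX.submatrix (Equiv.prodAssoc q a (Fin k)).symm)).submatrix
    (Equiv.prodAssoc r a (Fin k))

theorem IsCompletelyPositive.actSnd {N : SuperOp q r} (hN : IsCompletelyPositive N) (a : Type)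
    [Fintype a] : IsCompletelyPositive (actSnd a N) := fun k _ hX =>
  (hN.posSemidef (a × Fin k)
    (hX.submatrix fun p : q × (a × Fin k) => ((p.2.1, p.1), p.2.2))).submatrix
    fun p : (a × r) × Fin k => (p.1.2, (p.1.1, p.2))

theorem isCompletelyPositive_id : IsCompletelyPositive (LinearMap.id : SuperOp q q) :=
  fun _ _ hX => hX

variable [Fintype q] [Fintype r] [Fintype u]

theorem IsTracePreserving.comp {N : SuperOp q r} {M : SuperOp r u}
    (hM : IsTracePreserving M) (hN : IsTracePreserving N) : IsTracePreserving (M ∘ₗ N) :=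
  fun X => (hM _).trans (hN X)

theorem IsTracePreserving.actFst {N : SuperOp q r} (hN : IsTracePreserving N) (a : Type)
    [Fintype a] : IsTracePreserving (actFst N a) := fun X => by
  simp only [Matrix.trace, Fintype.sum_prod_type_right]
  exact Finset.sum_congr rfl fun k _ => hN (Matrix.of fun i j => X (i, k) (j, k))

theorem IsTracePreserving.actSnd {N : SuperOp q r} (hN : IsTracePreserving N) (a : Type)
    [Fintype a] : IsTracePreserving (actSnd a N) := fun X => by
  simp only [Matrix.trace, Fintype.sum_prod_type]
  exact Finset.sum_congr rfl fun k _ => hN (Matrix.of fun i j => X (k, i) (k, j))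

theorem IsOperation.comp {N : SuperOp q r} {M : SuperOp r u}
    (hM : IsOperation M) (hN : IsOperation N) : IsOperation (M ∘ₗ N) :=
  ⟨hM.1.comp hN.1, hM.2.comp hN.2⟩

theorem ForwardAssistedCode.applyTo_isOperation {K : ℕ} (C : ForwardAssistedCode q r K)
    {N : SuperOp q r} (hN : IsOperation N) : IsOperation (C.applyTo N) := by
  let := C.fintypeQ
  let := C.fintypeR
  exact C.dec_isOperation.comp (IsOperation.comp ⟨hN.1.actFst _, hN.2.actFst _⟩
    (IsOperation.comp ⟨C.side_isOperation.1.actSnd _, C.side_isOperation.2.actSnd _⟩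
      C.enc_isOperation))

theorem ForwardAssistedCode.applyTo_isTracePreserving {K : ℕ} (C : ForwardAssistedCode q r K)
    {N : SuperOp q r} (hN : IsTracePreserving N) : IsTracePreserving (C.applyTo N) := by
  let := C.fintypeQ
  let := C.fintypeR
  exact C.dec_isOperation.2.comp ((hN.actFst _).comp
    ((C.side_isOperation.2.actSnd _).comp C.enc_isOperation.2))

end CompletePositivity

/-! ### Choi matrices -/

section Choi

variable {q r : Type} [Fintype q] [DecidableEq q]

/-- The Choi matrix of a linear map between operator spaces. -/
def choi (N : SuperOp q r) : Matrix (q × r) (q × r) ℂ :=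
  Matrix.of fun s t => N (Matrix.single s.1 t.1 1) s.2 t.2

theorem apply_eq_sum_choi (N : SuperOp q r) (X : Matrix q q ℂ) (s t : r) :
    N X s t = ∑ i, ∑ j, choi N (i, s) (j, t) * X i j := by
  conv_lhs => rw [Matrix.matrix_eq_sum_single X]
  simp only [map_sum, Matrix.sum_apply, choi, Matrix.of_apply]
  refine Finset.sum_congr rfl fun i _ => Finset.sum_congr rfl fun j _ => ?_
  have : Matrix.single i j (X i j) = X i j • Matrix.single i j (1 : ℂ) := by simp
  rw [this, map_smul, Matrix.smul_apply, smul_eq_mul, mul_comm]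

theorem ext_of_choi {N M : SuperOp q r} (h : choi N = choi M) : N = M := by
  ext1 X
  ext s t
  rw [apply_eq_sum_choi, apply_eq_sum_choi M, h]

theorem isCompletelyPositive_of_choi [Fintype r] {N : SuperOp q r} (h : (choi N).PosSemidef) :
    IsCompletelyPositive N := fun k X hX => by
  convert link_posSemidef h hX using 1
  ext s t
  simp only [actFst, LinearMap.coe_mk, AddHom.coe_mk, Matrix.of_apply, link]
  rw [apply_eq_sum_choi]
  rfl

end Choi

/-! ### Maximally entangled state, swap operator and channel fidelity -/

section Fidelity

/-- The operator exchanging two copies of a system. -/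
def swapOp (q : Type) [DecidableEq q] : Matrix (q × q) (q × q) ℂ :=
  Matrix.of fun s t => if s.1 = t.2 ∧ s.2 = t.1 then 1 else 0

theorem swapOp_conjTranspose {q : Type} [DecidableEq q] : (swapOp q)ᴴ = swapOp q := by
  ext s t
  simp only [swapOp, Matrix.conjTranspose_apply, Matrix.of_apply, apply_ite star, star_one,
    star_zero]
  congr 1
  simp only [eq_comm, and_comm]

variable {q : Type} [Fintype q] [DecidableEq q]

theorem maxEnt_apply (s t : q × q) : maxEnt q s t =
    if s.1 = s.2 ∧ t.1 = t.2 then ((Fintype.card q : ℂ))⁻¹ else 0 := by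
  have h : ((Real.sqrt (Fintype.card q) : ℝ) : ℂ)⁻¹ * ((Real.sqrt (Fintype.card q) : ℝ) : ℂ)⁻¹ =
      (Fintype.card q : ℂ)⁻¹ := by
    rw [← mul_inv, ← Complex.ofReal_mul, Real.mul_self_sqrt (Nat.cast_nonneg _)]
    simp
  by_cases h1 : s.1 = s.2 <;> by_cases h2 : t.1 = t.2 <;>
    simp [maxEnt, Matrix.vecMulVec_apply, maxEntVec, h1, h2, h]

theorem maxEnt_posSemidef : (maxEnt q).PosSemidef := Matrix.posSemidef_vecMulVec_self_star _

theorem maxEnt_trace [Nonempty q] : (maxEnt q).trace = 1 := by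
  simp [Matrix.trace, maxEnt_apply, Fintype.sum_prod_type]

theorem maxEnt_mul_self : maxEnt q * maxEnt q = maxEnt q := by
  rcases isEmpty_or_nonempty q with h | h
  · ext s
    exact h.elim s.1
  · ext s t
    by_cases h1 : s.1 = s.2 <;> by_cases h2 : t.1 = t.2 <;>
      simp [Matrix.mul_apply, maxEnt_apply, Fintype.sum_prod_type, h1, h2]

theorem one_sub_maxEnt_posSemidef : (1 - maxEnt q).PosSemidef := by
  apply posSemidef_of_idempotent
  · simp [maxEnt_posSemidef.isHermitian.eq]
  · simp [sub_mul, mul_sub, maxEnt_mul_self]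

theorem swapOp_mul_self : swapOp q * swapOp q = 1 := by
  ext ⟨a, b⟩ ⟨c, d⟩
  simp only [swapOp, Matrix.mul_apply, Matrix.of_apply, Fintype.sum_prod_type, ite_and,
    Matrix.one_apply, Prod.mk.injEq, mul_ite, mul_one, mul_zero]
  simp

theorem one_add_swapOp_posSemidef : (1 + swapOp q).PosSemidef := by
  have : ((2 : ℂ)⁻¹ • (1 + swapOp q)).PosSemidef := by
    apply posSemidef_of_idempotent
    · simp [swapOp_conjTranspose]
    · simp only [Matrix.smul_mul, Matrix.mul_smul, add_mul, mul_add, swapOp_mul_self, one_mul,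
        mul_one]
      module
  convert this.smul (a := (2 : ℂ)) (by norm_num) using 1
  module

theorem one_sub_swapOp_posSemidef : (1 - swapOp q).PosSemidef := by
  have : ((2 : ℂ)⁻¹ • (1 - swapOp q)).PosSemidef := by
    apply posSemidef_of_idempotent
    · simp [swapOp_conjTranspose]
    · simp only [Matrix.smul_mul, Matrix.mul_smul, sub_mul, mul_sub, swapOp_mul_self, one_mul,
        mul_one]
      module
  convert this.smul (a := (2 : ℂ)) (by norm_num) using 1
  module

theorem actFst_maxEnt_apply (M : SuperOp q q) (s t : q × q) :
    actFst M q (maxEnt q) s t = (Fintype.card q : ℂ)⁻¹ * choi M (s.2, s.1) (t.2, t.1) := by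
  have : (Matrix.of fun i j => maxEnt q (i, s.2) (j, t.2)) =
      (Fintype.card q : ℂ)⁻¹ • Matrix.single s.2 t.2 (1 : ℂ) := by
    ext i j
    simp [maxEnt_apply, Matrix.single_apply, eq_comm]
  simp only [actFst, LinearMap.coe_mk, AddHom.coe_mk, Matrix.of_apply, this, map_smul]
  rfl

theorem channelFidelity_eq (M : SuperOp q q) : channelFidelity M =
    ((Fintype.card q : ℂ)⁻¹ ^ 2 * ∑ i, ∑ j, choi M (i, i) (j, j)).re := by
  rw [channelFidelity]
  congr 1
  simp only [Matrix.trace, Matrix.diag_apply, Matrix.mul_apply, actFst_maxEnt_apply,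
    maxEnt_apply, Fintype.sum_prod_type, ite_and, ite_mul, zero_mul, Finset.sum_ite_irrel,
    Finset.sum_const_zero, Finset.sum_ite_eq, Finset.mem_univ, if_true]
  rw [Finset.sum_comm, Finset.mul_sum]
  refine Finset.sum_congr rfl fun i _ => ?_
  rw [Finset.mul_sum]
  exact Finset.sum_congr rfl fun j _ => by rw [sq, mul_assoc]

theorem channelFidelity_nonneg {M : SuperOp q q} (hM : IsCompletelyPositive M) :
    0 ≤ channelFidelity M :=
  trace_mul_re_nonneg maxEnt_posSemidef (hM.posSemidef q maxEnt_posSemidef)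

theorem channelFidelity_le_one [Nonempty q] {M : SuperOp q q} (hM : IsOperation M) :
    channelFidelity M ≤ 1 := by
  have h := trace_mul_re_nonneg one_sub_maxEnt_posSemidef (hM.1.posSemidef q maxEnt_posSemidef)
  rw [sub_mul, one_mul, Matrix.trace_sub, (hM.2.actFst q) (maxEnt q), maxEnt_trace] at h
  rw [channelFidelity]
  simpa using h

/-- No positivity of the maps or coefficients is needed, which allows test maps that are signed
combinations of channels. -/
theorem channelFidelity_sum_smul {ι : Type*} (s : Finset ι) (a : ι → ℝ) (M : ι → SuperOp q q) :
    channelFidelity (∑ i ∈ s, (a i : ℂ) • M i) = ∑ i ∈ s, a i * channelFidelity (M i) := by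
  have (i : ι) : a i * channelFidelity (M i) =
      ((a i : ℂ) * (maxEnt q * actFst (M i) q (maxEnt q)).trace).re := by
    rw [Complex.re_ofReal_mul, channelFidelity]
  simp only [this]
  rw [← Complex.re_sum, channelFidelity]
  congr 1
  have h : actFst (∑ i ∈ s, (a i : ℂ) • M i) q (maxEnt q) =
      ∑ i ∈ s, (a i : ℂ) • actFst (M i) q (maxEnt q) := by
    ext x y
    simp [actFst, Matrix.sum_apply]
  rw [h, Finset.mul_sum, Matrix.trace_sum]
  simp

end Fidelity

/-! ### Tensor products of operators and of maps -/

section TensorProducts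

variable {n : ℕ} {q r : Type}

theorem sum_prod_eq_prod_sum {R : Type*} [CommSemiring R] [Fintype q] (f : Fin n → q → R) :
    ∑ s : Fin n → q, ∏ i, f i (s i) = ∏ i, ∑ a, f i a := by
  rw [Finset.prod_univ_sum, Fintype.piFinset_univ]

/-- The tensor product of `n` bipartite operators. -/
def tens (A : Fin n → Matrix (q × r) (q × r) ℂ) :
    Matrix ((Fin n → q) × (Fin n → r)) ((Fin n → q) × (Fin n → r)) ℂ :=
  Matrix.of fun s t => ∏ i, A i (s.1 i, s.2 i) (t.1 i, t.2 i)

/-- Splitting every factor into rank one terms and expanding the product gives rank one terms,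
indexed by a choice `κ` of one term in each factor. -/
theorem tens_posSemidef [Fintype q] [Fintype r] {A : Fin n → Matrix (q × r) (q × r) ℂ}
    (hA : ∀ i, (A i).PosSemidef) : (tens A).PosSemidef := by
  choose m v hv using fun i => Matrix.posSemidef_iff_eq_sum_vecMulVec.mp (hA i)
  have : tens A = ∑ κ : ∀ i, Fin (m i), Matrix.vecMulVec
      (fun s : (Fin n → q) × (Fin n → r) => ∏ i, v i (κ i) (s.1 i, s.2 i))
      (star fun s : (Fin n → q) × (Fin n → r) => ∏ i, v i (κ i) (s.1 i, s.2 i)) := by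
    ext s t
    simp only [tens, Matrix.of_apply, Matrix.sum_apply, Matrix.vecMulVec_apply, Pi.star_apply,
      star_prod, ← Finset.prod_mul_distrib]
    rw [← Fintype.piFinset_univ, ← Finset.prod_univ_sum (fun i => univ)
      fun i κ => v i κ (s.1 i, s.2 i) * star (v i κ (t.1 i, t.2 i))]
    refine Finset.prod_congr rfl fun i _ => ?_
    conv_lhs => rw [hv i]
    simp [Matrix.sum_apply, Matrix.vecMulVec_apply]
  rw [this]
  exact Matrix.posSemidef_sum _ fun κ _ => Matrix.posSemidef_vecMulVec_self_star _

theorem tens_sum_smul (c : Fin n → Bool → ℂ) (A : Fin n → Bool → Matrix (q × r) (q × r) ℂ) :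
    tens (fun i => ∑ b, c i b • A i b) =
      ∑ s : Fin n → Bool, (∏ i, c i (s i)) • tens fun i => A i (s i) := by
  ext s t
  simp only [tens, Matrix.of_apply, Matrix.sum_apply, Matrix.smul_apply, smul_eq_mul,
    ← Finset.prod_mul_distrib]
  rw [sum_prod_eq_prod_sum fun i b => c i b * A i b (s.1 i, s.2 i) (t.1 i, t.2 i)]

theorem tens_one [DecidableEq q] [DecidableEq r] :
    tens (fun _ : Fin n => (1 : Matrix (q × r) (q × r) ℂ)) = 1 := by
  ext s t
  simp only [tens, Matrix.of_apply, Matrix.one_apply, Prod.ext_iff, funext_iff,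
    Finset.prod_ite_zero, Finset.mem_univ, forall_true_left, Finset.prod_const_one, forall_and]

theorem trace_tens_mul_tens [Fintype q] [Fintype r] (A B : Fin n → Matrix (q × r) (q × r) ℂ) :
    (tens A * tens B).trace = ∏ i, (A i * B i).trace := by
  simp only [Matrix.trace, Matrix.diag_apply, Matrix.mul_apply, tens, Matrix.of_apply,
    ← Finset.prod_mul_distrib, Fintype.sum_prod_type]
  simp only [← sum_prod_eq_prod_sum]

variable [Fintype q] [DecidableEq q]

/-- The tensor product of `n` linear maps between operator spaces. -/
def tensorProd (N : Fin n → SuperOp q r) : SuperOp (Fin n → q) (Fin n → r) where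
  toFun X := Matrix.of fun s t =>
    ∑ f : Fin n → q, ∑ g : Fin n → q,
      X f g * ∏ i, N i (Matrix.single (f i) (g i) 1) (s i) (t i)
  map_add' X Y := by
    ext s t
    simp [add_mul, Finset.sum_add_distrib]
  map_smul' c X := by
    ext s t
    simp [Finset.mul_sum, mul_assoc]

theorem choi_tensorProd (N : Fin n → SuperOp q r) :
    choi (tensorProd N) = tens fun i => choi (N i) := by
  ext s t
  simp only [choi, tensorProd, tens, LinearMap.coe_mk, AddHom.coe_mk, Matrix.of_apply,
    Matrix.single_apply, ite_and, ite_mul, one_mul, zero_mul]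
  simp [Finset.sum_ite_irrel]

omit [Fintype q] in
theorem choi_sum_smul {ι : Type*} (s : Finset ι) (a : ι → ℂ) (M : ι → SuperOp q r) :
    choi (∑ i ∈ s, a i • M i) = ∑ i ∈ s, a i • choi (M i) := by
  ext x y
  simp [choi, Matrix.sum_apply]

theorem tensorProd_sum_smul (c : Fin n → Bool → ℂ) (N : Fin n → Bool → SuperOp q r) :
    tensorProd (fun i => ∑ b, c i b • N i b) =
      ∑ s : Fin n → Bool, (∏ i, c i (s i)) • tensorProd fun i => N i (s i) := by
  apply ext_of_choi
  simp only [choi_tensorProd, choi_sum_smul, tens_sum_smul]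

theorem sum_choi_of_isTracePreserving [Fintype r] {N : SuperOp q r} (hN : IsTracePreserving N)
    (i j : q) : ∑ b, choi N (i, b) (j, b) = if i = j then 1 else 0 := by
  refine (hN (Matrix.single i j 1)).trans ?_
  split_ifs with h
  · simp [h]
  · exact Matrix.trace_single_eq_of_ne _ _ _ h

theorem isTracePreserving_of_choi [Fintype r] {N : SuperOp q r}
    (h : ∀ i j, ∑ b, choi N (i, b) (j, b) = if i = j then 1 else 0) : IsTracePreserving N := by
  intro X
  simp only [Matrix.trace, Matrix.diag_apply, apply_eq_sum_choi N X]
  rw [Finset.sum_comm]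
  refine Finset.sum_congr rfl fun i _ => ?_
  rw [Finset.sum_comm]
  simp [← Finset.sum_mul, h]

theorem tensorProd_isTracePreserving [Fintype r] {N : Fin n → SuperOp q r}
    (h : ∀ i, IsTracePreserving (N i)) : IsTracePreserving (tensorProd N) := by
  refine isTracePreserving_of_choi fun f g => ?_
  simp only [choi_tensorProd, tens, Matrix.of_apply]
  rw [sum_prod_eq_prod_sum fun i b => choi (N i) (f i, b) (g i, b)]
  simp [sum_choi_of_isTracePreserving (h _), Finset.prod_ite_zero, funext_iff]

theorem tensorProd_isOperation [Fintype r] {N : Fin n → SuperOp q r}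
    (h1 : ∀ i, (choi (N i)).PosSemidef) (h2 : ∀ i, IsTracePreserving (N i)) :
    IsOperation (tensorProd N) :=
  ⟨isCompletelyPositive_of_choi (by rw [choi_tensorProd]; exact tens_posSemidef h1),
    tensorProd_isTracePreserving h2⟩

end TensorProducts

/-! ### Sums over bit strings and the coefficients of the linear program -/

section Weights

open Polynomial

variable {n : ℕ}

/-- The number of entries equal to `true`. -/
def weight (s : Fin n → Bool) : Fin (n + 1) :=
  ⟨#{i | s i = true}, Nat.lt_succ_of_le ((Finset.card_filter_le _ _).trans (by simp))⟩

theorem prod_ite_eq_pow_weight {R : Type*} [CommMonoid R] (s : Fin n → Bool) (a b : R) :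
    ∏ i, (if s i then b else a) = a ^ (n - (weight s : ℕ)) * b ^ (weight s : ℕ) := by
  rw [Finset.prod_ite, Finset.prod_const, Finset.prod_const, mul_comm]
  congr 2
  have := Finset.card_filter_add_card_filter_not (s := univ) (fun i => s i = true)
  rw [Finset.card_univ, Fintype.card_fin] at this
  simp only [weight]
  omega

/-- Generating function: in the product of the linear polynomials, a string $s$ contributes to the
coefficient of $X^{|s|}$. -/
theorem sum_weight_mul_prod (y : Fin (n + 1) → ℝ) (u : Fin n → Bool → ℝ) :
    ∑ s : Fin n → Bool, (∏ i, u i (s i)) * y (weight s) =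
      ∑ j : Fin (n + 1), (∏ i, (C (u i false) + C (u i true) * X)).coeff j * y j := by
  have h : ∏ i, (C (u i false) + C (u i true) * X) =
      ∑ s : Fin n → Bool, C (∏ i, u i (s i)) * X ^ (weight s : ℕ) := by
    have h1 (i : Fin n) : C (u i false) + C (u i true) * X =
        ∑ b : Bool, C (u i b) * (if b then X else 1) := by simp [add_comm]
    simp only [h1]
    rw [← sum_prod_eq_prod_sum]
    refine Finset.sum_congr rfl fun s _ => ?_
    rw [Finset.prod_mul_distrib, prod_ite_eq_pow_weight, one_pow, one_mul, map_prod]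
  simp only [h, finsetSum_coeff, coeff_C_mul_X_pow, Finset.sum_mul]
  rw [Finset.sum_comm]
  refine Finset.sum_congr rfl fun s _ => ?_
  simp [Fin.val_inj, ite_mul]

theorem coeff_linear_pow (a b : ℝ) (m k : ℕ) :
    ((C a + C b * X) ^ m).coeff k = m.choose k * a ^ (m - k) * b ^ k := by
  rw [add_comm, add_pow, finsetSum_coeff]
  have (i : ℕ) : ((C b * X) ^ i * C a ^ (m - i) * (m.choose i : ℝ[X])).coeff k =
      if k = i then m.choose k * a ^ (m - k) * b ^ k else 0 := by
    have : ((C b * X) ^ i * C a ^ (m - i) * (m.choose i : ℝ[X])) =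
        C (b ^ i * a ^ (m - i) * m.choose i) * X ^ i := by
      simp only [mul_pow, map_mul, map_pow, map_natCast]
      ring
    rw [this, coeff_C_mul_X_pow]
    split_ifs with h
    · subst h; ring
    · rfl
  simp only [this]
  rw [Finset.sum_ite_eq]
  split_ifs with h
  · rfl
  · rw [Nat.choose_eq_zero_of_lt (by simpa [Nat.lt_succ_iff] using h)]
    simp

theorem sum_weight_mul_prod_const (y : Fin (n + 1) → ℝ) (u : Bool → ℝ) :
    ∑ s : Fin n → Bool, (∏ i, u (s i)) * y (weight s) =
      ∑ j : Fin (n + 1), (n.choose j : ℝ) * u false ^ (n - (j : ℕ)) * u true ^ (j : ℕ) * y j := by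
  rw [sum_weight_mul_prod y fun _ => u]
  simp [coeff_linear_pow]

/-- `ptCoeff d t b` is the eigenvalue of the partial transpose of the symmetric (`b = false`) or
antisymmetric (`b = true`) projection on the maximally entangled vector (`t = true`) or on its
orthogonal complement (`t = false`). -/
def ptCoeff (d : ℕ) : Bool → Bool → ℝ
  | false, _ => 1 / 2
  | true, false => (1 + d) / 2
  | true, true => (1 - d) / 2

/-- For $t$ of weight $w$ the generating function is
$\big(\tfrac{1+X}2\big)^{n-w}\big(\tfrac{(1+d)+(1-d)X}2\big)^w$, and the convolution of the two
binomial expansions is the formula for $M_{wj}$. -/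
theorem sum_weight_mul_ptCoeff (d : ℕ) (y : Fin (n + 1) → ℝ) (t : Fin n → Bool) :
    ∑ s : Fin n → Bool, (∏ i, ptCoeff d (t i) (s i)) * y (weight s) =
      ∑ j : Fin (n + 1), lpM d n (weight t) j * y j := by
  rw [sum_weight_mul_prod y fun i => ptCoeff d (t i)]
  refine Finset.sum_congr rfl fun j _ => ?_
  congr 1
  have h (i : Fin n) : C (ptCoeff d (t i) false) + C (ptCoeff d (t i) true) * X =
      if t i then C ((1 + (d : ℝ)) / 2) + C ((1 - (d : ℝ)) / 2) * X
        else C (1 / 2) + C (1 / 2) * X := by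
    cases t i <;> simp [ptCoeff]
  simp only [h]
  rw [prod_ite_eq_pow_weight, mul_comm, coeff_mul,
    Finset.Nat.sum_antidiagonal_eq_sum_range_succ_mk]
  simp only [coeff_linear_pow, lpM]
  generalize hw : (weight t : ℕ) = w
  have hwn : w ≤ n := hw ▸ Nat.lt_succ_iff.mp (weight t).2
  rw [Finset.mul_sum]
  symm
  -- The convolution runs over $k\le j$, `lpM` only over $k\le\min(w,j)$; the extra terms contain
  -- $\binom wk=0$.
  refine Finset.sum_subset_zero_on_sdiff (Finset.range_subset_range.mpr (by omega)) ?_ ?_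
  · intro k hk
    rw [Nat.choose_eq_zero_of_lt (n := w) (k := k)]
    · simp
    · simp only [Finset.mem_sdiff, Finset.mem_range] at hk
      omega
  · intro k hk
    simp only [Finset.mem_range] at hk
    -- The powers of two add up to $2^n$ only if the truncated subtraction $n-w-(j-k)$ is exact;
    -- otherwise $\binom{n-w}{j-k}=0$.
    by_cases hc : (j : ℕ) - k ≤ n - w
    · have e1 : n = (n - w - (j - k)) + (j - k) + (w - k) + k := by omega
      rw [div_pow, div_pow, one_div, inv_pow, inv_pow]
      conv_lhs => rw [show (2 : ℝ) ^ n = 2 ^ (n - w - (j - k)) * 2 ^ ((j : ℕ) - k) * 2 ^ (w - k) *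
        2 ^ k by rw [← pow_add, ← pow_add, ← pow_add, ← e1]]
      field_simp
    · rw [Nat.choose_eq_zero_of_lt (n := n - w) (by omega)]
      simp

theorem exists_perm_of_weight_eq {s t : Fin n → Bool} (h : weight s = weight t) :
    ∃ σ : Equiv.Perm (Fin n), s = t ∘ σ := by
  have h1 : #{i | s i = true} = #{i | t i = true} := congrArg Fin.val h
  have h2 : Fintype.card {i // s i = true} = Fintype.card {i // t i = true} := by
    rw [Fintype.card_subtype, Fintype.card_subtype, h1]
  let e := Fintype.equivOfCardEq h2
  refine ⟨e.extendSubtype, funext fun i => ?_⟩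
  by_cases hi : s i = true
  · rw [hi, Function.comp_apply, e.extendSubtype_mem i hi]
  · have := e.extendSubtype_not_mem i hi
    simp_all

theorem exists_weight_eq (j : Fin (n + 1)) : ∃ s : Fin n → Bool, weight s = j := by
  refine ⟨fun i => decide ((i : ℕ) < j), Fin.ext ?_⟩
  have : (j : ℕ) ≤ n := Nat.lt_succ_iff.mp j.2
  simp only [weight, decide_eq_true_eq]
  simp [Fin.card_filter_val_lt, this]

end Weights

/-! ### Transposition, trace map and the complement of the identity -/

section Maps

variable {q r : Type}

/-- The transposition map. -/
def transposeMap (q : Type) : SuperOp q q :=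
  (Matrix.transposeLinearEquiv q q ℂ ℂ).toLinearMap

theorem transposeMap_apply (X : Matrix q q ℂ) : transposeMap q X = Xᵀ := rfl

variable [Fintype q] [DecidableEq q]

/-- The map `X ↦ 1 Tr X`. -/
def traceMap (q : Type) [Fintype q] [DecidableEq q] : SuperOp q q :=
  (Matrix.traceLinearMap q ℂ ℂ).smulRight (1 : Matrix q q ℂ)

theorem traceMap_apply (X : Matrix q q ℂ) : traceMap q X = X.trace • 1 := rfl

theorem choi_id : choi (LinearMap.id : SuperOp q q) = (Fintype.card q : ℂ) • maxEnt q := by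
  ext s t
  have : Nonempty q := ⟨s.1⟩
  simp [choi, maxEnt_apply, Matrix.single_apply]

theorem choi_traceMap : choi (traceMap q) = 1 := by
  ext ⟨a, b⟩ ⟨c, e⟩
  by_cases h : a = c
  · subst h
    simp [choi, traceMap_apply, Matrix.one_apply]
  · simp [choi, traceMap_apply, h, Matrix.trace_single_eq_of_ne]

omit [Fintype q] in
theorem choi_transposeMap : choi (transposeMap q) = swapOp q := by
  ext ⟨a, b⟩ ⟨c, e⟩
  simp only [choi, transposeMap_apply, swapOp, Matrix.of_apply, Matrix.transpose_apply,
    Matrix.single_apply]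
  congr 1
  simp only [eq_comm]

omit [Fintype q] in
theorem choi_add (N M : SuperOp q r) : choi (N + M) = choi N + choi M := rfl

omit [Fintype q] in
theorem choi_sub (N M : SuperOp q r) : choi (N - M) = choi N - choi M := rfl

omit [Fintype q] in
theorem choi_smul (c : ℂ) (N : SuperOp q r) : choi (c • N) = c • choi N := rfl

/-- The map `X ↦ (d 1 Tr X - X) / (d² - 1)`, where `d` is the dimension. -/
def complMap (q : Type) [Fintype q] [DecidableEq q] : SuperOp q q :=
  ((((Fintype.card q : ℝ) ^ 2 - 1)⁻¹ : ℝ) : ℂ) •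
    ((Fintype.card q : ℂ) • traceMap q - LinearMap.id)

/-- The Choi matrix is a nonnegative multiple of $1-\phi$. In dimension 1 the scalar is $0^{-1}=0$,
so positivity survives but trace preservation does not. -/
theorem choi_complMap_posSemidef [Nonempty q] : (choi (complMap q)).PosSemidef := by
  have h1 : (1 : ℝ) ≤ Fintype.card q := by exact_mod_cast Fintype.card_pos (α := q)
  have h2 : (0 : ℝ) ≤ ((Fintype.card q : ℝ) ^ 2 - 1)⁻¹ := inv_nonneg.mpr (by nlinarith)
  have h3 : (0 : ℂ) ≤ Fintype.card q := by positivity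
  rw [complMap, choi_smul, choi_sub, choi_smul, choi_traceMap, choi_id, ← smul_sub]
  exact (one_sub_maxEnt_posSemidef.smul h3).smul (by exact_mod_cast h2)

theorem complMap_isTracePreserving (h : 2 ≤ Fintype.card q) : IsTracePreserving (complMap q) := by
  intro X
  have h1 : (2 : ℝ) ≤ Fintype.card q := by exact_mod_cast h
  have h2 : ((Fintype.card q : ℝ) ^ 2 - 1) ≠ 0 := by nlinarith
  have h3 : ((Fintype.card q : ℂ) ^ 2 - 1) ≠ 0 := by exact_mod_cast h2
  simp only [complMap, LinearMap.smul_apply, LinearMap.sub_apply, traceMap_apply,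
    Matrix.trace_smul, Matrix.trace_sub, LinearMap.id_apply, Matrix.trace_one, smul_eq_mul]
  push_cast
  field_simp

end Maps

/-! ### Test maps as combinations of the extreme Werner–Holevo channels -/

section WernerHolevo

/-- The two extreme Werner-Holevo channels. -/
def wernerPair (d : ℕ) (b : Bool) : SuperOp (Fin d) (Fin d) :=
  if b then wernerHolevoOne d else wernerHolevoZero d

theorem wernerHolevoZero_eq (d : ℕ) : wernerHolevoZero d =
    ((((d : ℝ) + 1)⁻¹ : ℝ) : ℂ) • (traceMap (Fin d) + transposeMap (Fin d)) := by
  ext1 X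
  simp [wernerHolevoZero, traceMap_apply, transposeMap_apply]

theorem wernerHolevoOne_eq (d : ℕ) : wernerHolevoOne d =
    ((((d : ℝ) - 1)⁻¹ : ℝ) : ℂ) • (traceMap (Fin d) - transposeMap (Fin d)) := by
  ext1 X
  simp [wernerHolevoOne, traceMap_apply, transposeMap_apply]

theorem wernerPair_isOperation {d : ℕ} (hd : 2 ≤ d) (b : Bool) :
    (choi (wernerPair d b)).PosSemidef ∧ IsTracePreserving (wernerPair d b) := by
  have h1 : (2 : ℝ) ≤ d := by exact_mod_cast hd
  have h2 : ((d : ℂ) - 1) ≠ 0 := by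
    have : ((d : ℝ) - 1) ≠ 0 := by linarith
    exact_mod_cast this
  have h3 : ((d : ℂ) + 1) ≠ 0 := by
    have : ((d : ℝ) + 1) ≠ 0 := by linarith
    exact_mod_cast this
  cases b
  · refine ⟨?_, fun X => ?_⟩
    · simp only [wernerPair, wernerHolevoZero_eq, Bool.false_eq_true, if_false]
      rw [choi_smul, choi_add, choi_traceMap, choi_transposeMap]
      refine one_add_swapOp_posSemidef.smul ?_
      exact_mod_cast inv_nonneg.mpr (by linarith : (0 : ℝ) ≤ (d : ℝ) + 1)
    · simp only [wernerPair, wernerHolevoZero, Bool.false_eq_true, if_false, LinearMap.coe_mk,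
        AddHom.coe_mk, Matrix.trace_smul, Matrix.trace_add, Matrix.trace_one, smul_eq_mul,
        Matrix.trace_transpose, Fintype.card_fin]
      field_simp
  · refine ⟨?_, fun X => ?_⟩
    · simp only [wernerPair, wernerHolevoOne_eq, if_true]
      rw [choi_smul, choi_sub, choi_traceMap, choi_transposeMap]
      refine one_sub_swapOp_posSemidef.smul ?_
      exact_mod_cast inv_nonneg.mpr (by linarith : (0 : ℝ) ≤ (d : ℝ) - 1)
    · simp only [wernerPair, wernerHolevoOne, if_true, LinearMap.coe_mk,
        AddHom.coe_mk, Matrix.trace_smul, Matrix.trace_sub, Matrix.trace_one, smul_eq_mul,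
        Matrix.trace_transpose, Fintype.card_fin]
      field_simp

theorem wernerHolevo_eq_sum (d : ℕ) (α : ℝ) : wernerHolevo d α =
    ∑ b : Bool, (((if b then α else 1 - α : ℝ)) : ℂ) • wernerPair d b := by
  simp [wernerHolevo, wernerPair, add_comm]

/-- With these weights each channel contributes half of $\mathbb 1\,\mathrm{Tr}X\pm X^{\mathrm T}$
and the transposes cancel. The $n$-th tensor power produces the coefficients $g_j$. -/
theorem traceMap_eq_sum {d : ℕ} (hd : 2 ≤ d) : traceMap (Fin d) =
    ∑ b : Bool, (((if b then ((d : ℝ) - 1) / 2 else ((d : ℝ) + 1) / 2 : ℝ)) : ℂ) •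
      wernerPair d b := by
  have h1 : (2 : ℝ) ≤ d := by exact_mod_cast hd
  have h2 : ((d : ℝ) - 1) ≠ 0 := by linarith
  have h3 : ((d : ℝ) + 1) ≠ 0 := by linarith
  simp only [Fintype.sum_bool, wernerPair, if_true, Bool.false_eq_true, if_false,
    wernerHolevoZero_eq, wernerHolevoOne_eq, smul_smul, ← Complex.ofReal_mul]
  rw [show ((d : ℝ) - 1) / 2 * ((d : ℝ) - 1)⁻¹ = 1 / 2 by field_simp,
    show ((d : ℝ) + 1) / 2 * ((d : ℝ) + 1)⁻¹ = 1 / 2 by field_simp]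
  push_cast
  module

/-- The transposes of the identity and of `complMap`. -/
theorem transposeMap_comp_eq_sum {d : ℕ} (hd : 2 ≤ d) (t : Bool) :
    transposeMap (Fin d) ∘ₗ (if t then LinearMap.id else complMap (Fin d)) =
      ∑ b : Bool, (ptCoeff d t b : ℂ) • wernerPair d b := by
  have h1 : (2 : ℝ) ≤ d := by exact_mod_cast hd
  have h2 : ((d : ℝ) - 1) ≠ 0 := by linarith
  have h3 : ((d : ℝ) + 1) ≠ 0 := by linarith
  have h4 : ((d : ℝ) ^ 2 - 1) ≠ 0 := by nlinarith
  simp only [Fintype.sum_bool, wernerPair, if_true, Bool.false_eq_true, if_false,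
    wernerHolevoZero_eq, wernerHolevoOne_eq, smul_smul, ← Complex.ofReal_mul]
  cases t
  · have e : transposeMap (Fin d) ∘ₗ complMap (Fin d) =
        ((((d : ℝ) ^ 2 - 1)⁻¹ : ℝ) : ℂ) • ((d : ℂ) • traceMap (Fin d) - transposeMap (Fin d)) := by
      ext1 X
      simp [complMap, transposeMap_apply, traceMap_apply]
    have e1 : ptCoeff d false true * ((d : ℝ) - 1)⁻¹ =
        ((d : ℝ) ^ 2 - 1)⁻¹ * ((d + 1) / 2) := by
      simp only [ptCoeff]; field_simp; ring
    have e2 : ptCoeff d false false * ((d : ℝ) + 1)⁻¹ =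
        ((d : ℝ) ^ 2 - 1)⁻¹ * ((d - 1) / 2) := by
      simp only [ptCoeff]; field_simp; ring
    simp only [Bool.false_eq_true, if_false]
    rw [e, e1, e2]
    push_cast
    module
  · have e1 : ptCoeff d true true * ((d : ℝ) - 1)⁻¹ = - (1 / 2) := by
      simp only [ptCoeff]; field_simp; ring
    have e2 : ptCoeff d true false * ((d : ℝ) + 1)⁻¹ = 1 / 2 := by
      simp only [ptCoeff]; field_simp; ring
    simp only [if_true, LinearMap.comp_id]
    rw [e1, e2]
    push_cast
    module

end WernerHolevo

/-! ### Fidelity bounds for non-signalling and PPT-preserving codes -/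

section CodeFidelity

variable {q r : Type} [Fintype q] [Fintype r] {K : ℕ} (C : ForwardAssistedCode q r K)

theorem ForwardAssistedCode.applyTo_sum_smul {ι : Type*} (s : Finset ι) (c : ι → ℂ)
    (N : ι → SuperOp q r) :
    C.applyTo (∑ i ∈ s, c i • N i) = ∑ i ∈ s, c i • C.applyTo (N i) := by
  have h : actFst (∑ i ∈ s, c i • N i) C.R = ∑ i ∈ s, c i • actFst (N i) C.R := by
    ext1 X
    ext x y
    simp [actFst, Matrix.sum_apply]
  ext1 X
  simp [ForwardAssistedCode.applyTo, h, map_sum]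

theorem ForwardAssistedCode.channelFidelity_applyTo_sum {ι : Type*} (s : Finset ι) (c : ι → ℝ)
    (N : ι → SuperOp q r) :
    channelFidelity (C.applyTo (∑ i ∈ s, (c i : ℂ) • N i)) =
      ∑ i ∈ s, c i * channelFidelity (C.applyTo (N i)) := by
  rw [C.applyTo_sum_smul s fun i => (c i : ℂ), channelFidelity_sum_smul]

variable [DecidableEq q] [DecidableEq r]

/-- The action of a code with a channel in terms of its bipartite operation and the Choi matrix of
the channel. -/
theorem ForwardAssistedCode.applyTo_apply (N : SuperOp q r) (X : Matrix (Fin K) (Fin K) ℂ)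
    (s t : Fin K) :
    C.applyTo N X s t = ∑ a, ∑ a', ∑ b, ∑ b', choi N (a, b) (a', b') *
      C.bipartite (Matrix.of fun x y => X x.1 y.1 * Matrix.single b b' (1 : ℂ) x.2 y.2)
        (a, s) (a', t) := by
  let Y (a a' : q) (b b' : r) : Matrix (r × C.R) (r × C.R) ℂ :=
    Matrix.of fun x y => Matrix.single b b' (1 : ℂ) x.1 y.1 *
      C.side (Matrix.of fun i j => C.enc X (a, i) (a', j)) x.2 y.2
  have h1 (a a' b b') : C.bipartite
      (Matrix.of fun x y => X x.1 y.1 * Matrix.single b b' (1 : ℂ) x.2 y.2) (a, s) (a', t) =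
      C.dec (Y a a' b b') s t := by
    have e (c c' : r) : C.enc (Matrix.of fun i j => X i j * Matrix.single b b' (1 : ℂ) c c') =
        Matrix.single b b' (1 : ℂ) c c' • C.enc X := by
      rw [← map_smul]
      congr 1
      ext i j
      simp [mul_comm]
    have e2 : (Matrix.of fun (x y : r × C.R) => C.side (Matrix.of fun i j =>
        C.enc (Matrix.of fun k l => X k l * Matrix.single b b' (1 : ℂ) x.1 y.1) (a, i) (a', j))
          x.2 y.2) = Y a a' b b' := by
      ext x y
      have : (Matrix.of fun i j => (Matrix.single b b' (1 : ℂ) x.1 y.1 • C.enc X) (a, i) (a', j)) =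
          Matrix.single b b' (1 : ℂ) x.1 y.1 • Matrix.of fun i j => C.enc X (a, i) (a', j) := rfl
      simp only [e, Matrix.of_apply, Y]
      rw [this, map_smul, Matrix.smul_apply, smul_eq_mul]
    rw [← e2]
    rfl
  have h2 : actFst N C.R (actSnd q C.side (C.enc X)) =
      ∑ a, ∑ a', ∑ b, ∑ b', choi N (a, b) (a', b') • Y a a' b b' := by
    ext x y
    simp only [actFst, LinearMap.coe_mk, AddHom.coe_mk, Matrix.of_apply, Matrix.sum_apply,
      Matrix.smul_apply, smul_eq_mul, Y]
    rw [apply_eq_sum_choi]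
    simp [actSnd, Matrix.single_apply, ite_and, Finset.sum_ite_irrel]
  simp only [h1]
  rw [show C.applyTo N X = C.dec (actFst N C.R (actSnd q C.side (C.enc X))) from rfl, h2]
  simp only [map_sum, map_smul, Matrix.sum_apply, Matrix.smul_apply, smul_eq_mul]

/-- A map with Choi matrix $1$ discards Alice's output and hands Bob the operator $\mathbb 1$. By
the NS condition the code then acts as $X\mapsto\mathrm{Tr}X\cdot Z(\mathbb 1)$, and the fidelity
only sees $\mathrm{Tr}\,Z(\mathbb 1)=\dim r$. -/
theorem ForwardAssistedCode.channelFidelity_of_nonSignalling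
    (hC : NonSignallingAliceToBob C.bipartite) {N : SuperOp q r} (hN : choi N = 1) :
    channelFidelity (C.applyTo N) = Fintype.card r / (K : ℝ) ^ 2 := by
  obtain ⟨Z, hZ, h⟩ := hC
  have h1 (X : Matrix (Fin K) (Fin K) ℂ) (s t : Fin K) :
      C.applyTo N X s t = X.trace * Z 1 s t := by
    have e1 : traceFst (Fin K) r
        (Matrix.of fun x y => X x.1 y.1 * (1 : Matrix r r ℂ) x.2 y.2) =
        X.trace • (1 : Matrix r r ℂ) := by
      ext x y
      simp [traceFst, Matrix.trace, Finset.sum_mul]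
    have e2 : (Matrix.of fun (x y : Fin K × r) => X x.1 y.1 * (1 : Matrix r r ℂ) x.2 y.2) =
        ∑ b, Matrix.of fun x y => X x.1 y.1 * Matrix.single b b (1 : ℂ) x.2 y.2 := by
      ext x y
      simp only [Matrix.sum_apply, Matrix.of_apply, ← Finset.mul_sum]
      congr 1
      simp [Matrix.single_apply, Matrix.one_apply, ite_and]
    have e3 := congrFun (congrFun (LinearMap.congr_fun h
      (Matrix.of fun x y => X x.1 y.1 * (1 : Matrix r r ℂ) x.2 y.2)) s) t
    rw [LinearMap.comp_apply, LinearMap.comp_apply, e1, map_smul, Matrix.smul_apply,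
      smul_eq_mul, e2] at e3
    rw [← e3, C.applyTo_apply, hN]
    simp only [traceFst, map_sum, LinearMap.coe_mk, AddHom.coe_mk, Matrix.of_apply,
      Matrix.sum_apply, Matrix.one_apply, Prod.mk.injEq, ite_and, ite_mul, one_mul, zero_mul]
    simp only [Finset.sum_ite_irrel, Finset.sum_const_zero, Finset.sum_ite_eq, Finset.mem_univ,
      if_true]
    exact Finset.sum_comm
  have h2 : (Z 1).trace = Fintype.card r := by rw [hZ.2, Matrix.trace_one]
  rw [channelFidelity_eq]
  have h3 : ∑ i, ∑ j, choi (C.applyTo N) (i, i) (j, j) = Fintype.card r := by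
    rw [← h2, Matrix.trace]
    refine Finset.sum_congr rfl fun i _ => ?_
    simp only [choi, Matrix.of_apply, h1]
    rw [Finset.sum_eq_single i]
    · simp
    · intro j _ hj
      rw [Matrix.trace_single_eq_of_ne _ _ _ hj.symm, zero_mul]
    · simp
  rw [h3, Fintype.card_fin]
  have : (((K : ℂ))⁻¹ ^ 2 * (Fintype.card r : ℂ)) =
      ((Fintype.card r / (K : ℝ) ^ 2 : ℝ) : ℂ) := by
    push_cast
    ring
  rw [this, Complex.ofReal_re]

/-- Apply the bipartite operation to $\phi_{A\tilde A}\otimes\phi_{B\tilde B}$, which is PPT.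
Contracting the transposed output `Ω` with the partially transposed Choi matrix of `N` shows that
`σ`, the partial transpose of the Choi state of the resulting map, is a state. Since $K\phi^\Gamma$
is the swap operator, the fidelity is $K^{-1}$ times the expectation of the swap in `σ`, which lies
in $[-1,1]$. -/
theorem ForwardAssistedCode.abs_channelFidelity_le_of_pptPreserving [Nonempty r]
    (hC : PPTPreserving C.bipartite) (hK : 1 ≤ K) {N : SuperOp q r} (hN : IsTracePreserving N)
    (hpt : (Matrix.of fun s t : q × r => choi N (s.1, t.2) (t.1, s.2)).PosSemidef) :
    |channelFidelity (C.applyTo N)| ≤ 1 / K := by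
  have : NeZero K := ⟨by omega⟩
  let ρ : Matrix ((Fin K × r) × (Fin K × r)) ((Fin K × r) × (Fin K × r)) ℂ :=
    Matrix.of fun s t => maxEnt (Fin K) (s.1.1, s.2.1) (t.1.1, t.2.1) *
      maxEnt r (s.1.2, s.2.2) (t.1.2, t.2.2)
  have hρ : ρ.PosSemidef :=
    (maxEnt_posSemidef.kronecker maxEnt_posSemidef).submatrix
      fun s : (Fin K × r) × (Fin K × r) => ((s.1.1, s.2.1), (s.1.2, s.2.2))
  have hρ1 : ρ.trace = 1 := by
    have h1 : (K : ℂ) ≠ 0 := by exact_mod_cast NeZero.ne K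
    have h2 : (Fintype.card r : ℂ) ≠ 0 := by simp
    simp [ρ, Matrix.trace, maxEnt_apply, Fintype.sum_prod_type]
    field_simp
  -- Bob holds both halves of $\phi_{B\tilde B}$, so his transposition is the full transposition of
  -- a real symmetric factor.
  have hρ2 : bobTranspose ρ = ρ := by
    ext s t
    simp only [bobTranspose, ρ, Matrix.of_apply, maxEnt_apply]
    congr 2
    exact propext and_comm
  have hΩ := hC (Fin K) r ρ ⟨hρ, hρ1⟩ (by rwa [hρ2])
  set Ω := bobTranspose (actFst C.bipartite (Fin K × r) ρ) with hΩdef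
  set M := C.applyTo N with hM
  have hΩ1 (a a' : q) (s s' i i' : Fin K) (b b' : r) :
      Ω ((a, s), (i, b)) ((a', s'), (i', b')) = (K : ℂ)⁻¹ * (Fintype.card r : ℂ)⁻¹ *
        C.bipartite (Matrix.of fun x y => Matrix.single i i' (1 : ℂ) x.1 y.1 *
          Matrix.single b' b (1 : ℂ) x.2 y.2) (a, s') (a', s) := by
    have : (Matrix.of fun x y => ρ (x, (i, b')) (y, (i', b))) =
        ((K : ℂ)⁻¹ * (Fintype.card r : ℂ)⁻¹) •
        (Matrix.of fun x y => Matrix.single i i' (1 : ℂ) x.1 y.1 *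
          Matrix.single b' b (1 : ℂ) x.2 y.2) := by
      ext x y
      simp only [ρ, Matrix.of_apply, maxEnt_apply, Matrix.smul_apply, smul_eq_mul,
        Matrix.single_apply, Fintype.card_fin, eq_comm]
      split_ifs <;> simp
    simp only [hΩdef, bobTranspose, actFst, LinearMap.coe_mk, AddHom.coe_mk, Matrix.of_apply,
      this, map_smul]
    rfl
  let σ : Matrix (Fin K × Fin K) (Fin K × Fin K) ℂ :=
    Matrix.of fun s t => (K : ℂ)⁻¹ * choi M (s.2, t.1) (t.2, s.1)
  have hσ : σ.PosSemidef := by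
    have h1 := (link_posSemidef (e := Unit) (k := Fin K × Fin K)
      (hpt.submatrix fun x : (q × r) × Unit => x.1)
      (hΩ.submatrix fun x : (q × r) × (Fin K × Fin K) => ((x.1.1, x.2.1), (x.2.2, x.1.2)))).submatrix
      fun x : Fin K × Fin K => ((), x)
    have h2 := h1.smul (a := (Fintype.card r : ℂ)) (by positivity)
    convert h2 using 1
    ext s t
    have hr : (Fintype.card r : ℂ) ≠ 0 := by simp
    simp only [σ, Matrix.of_apply, choi, Matrix.smul_apply, Matrix.submatrix_apply, link,
      smul_eq_mul, hΩ1]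
    rw [hM, C.applyTo_apply]
    simp only [Fintype.sum_prod_type, Finset.mul_sum]
    refine Finset.sum_congr rfl fun a _ => ?_
    conv_rhs => rw [Finset.sum_comm]
    refine Finset.sum_congr rfl fun a' _ => ?_
    rw [Finset.sum_comm]
    refine Finset.sum_congr rfl fun b _ => Finset.sum_congr rfl fun b' _ => ?_
    field_simp
    exact mul_comm _ _
  have htr : σ.trace = 1 := by
    have h1 := (C.applyTo_isTracePreserving hN).actFst (Fin K) (maxEnt (Fin K))
    rw [maxEnt_trace] at h1
    rw [← h1, Matrix.trace, Matrix.trace]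
    refine Finset.sum_congr rfl fun x _ => ?_
    simp [actFst_maxEnt_apply, σ, hM]
  have hfid : channelFidelity M = (K : ℝ)⁻¹ * (swapOp (Fin K) * σ).trace.re := by
    have : (swapOp (Fin K) * σ).trace = (K : ℂ)⁻¹ * ∑ i, ∑ j, choi M (i, i) (j, j) := by
      simp only [Matrix.trace, Matrix.diag_apply, Matrix.mul_apply, swapOp, σ, Matrix.of_apply,
        Fintype.sum_prod_type, ite_and, ite_mul, one_mul, zero_mul, Finset.mul_sum]
      simp
    rw [channelFidelity_eq, this, Fintype.card_fin, ← Complex.re_ofReal_mul]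
    push_cast
    ring_nf
  have h1 := trace_mul_re_nonneg one_add_swapOp_posSemidef hσ
  have h2 := trace_mul_re_nonneg one_sub_swapOp_posSemidef hσ
  rw [add_mul, one_mul, Matrix.trace_add, htr, Complex.add_re, Complex.one_re] at h1
  rw [sub_mul, one_mul, Matrix.trace_sub, htr, Complex.sub_re, Complex.one_re] at h2
  rw [hfid, abs_mul, abs_of_nonneg (by positivity : (0 : ℝ) ≤ (K : ℝ)⁻¹), one_div]
  exact mul_le_of_le_one_right (by positivity) (abs_le.mpr ⟨by linarith, by linarith⟩)

end CodeFidelity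

/-! ### Upper bound: every code yields a feasible point -/

section Converse

variable {n : ℕ}

/-- Averaging over permutations turns a function on bit strings into a function of the weight. -/
theorem exists_weight_average (f : (Fin n → Bool) → ℝ) : ∃ y : Fin (n + 1) → ℝ,
    (∀ a b, (∀ s, a ≤ f s ∧ f s ≤ b) → ∀ j, a ≤ y j ∧ y j ≤ b) ∧
    ∀ (u : Fin n → Bool → ℝ) (a b : ℝ),
      (∀ σ : Equiv.Perm (Fin n), a ≤ ∑ s, (∏ i, u (σ i) (s i)) * f s ∧
        ∑ s, (∏ i, u (σ i) (s i)) * f s ≤ b) →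
      a ≤ ∑ s, (∏ i, u i (s i)) * y (weight s) ∧
        ∑ s, (∏ i, u i (s i)) * y (weight s) ≤ b := by
  set w : ℝ := (Fintype.card (Equiv.Perm (Fin n)) : ℝ)⁻¹ with hw
  have hw0 : 0 ≤ w := by positivity
  have hw1 : w * Fintype.card (Equiv.Perm (Fin n)) = 1 := inv_mul_cancel₀ (by positivity)
  have avg {g : Equiv.Perm (Fin n) → ℝ} {a b : ℝ} (hg : ∀ σ, a ≤ g σ ∧ g σ ≤ b) :
      a ≤ w * ∑ σ, g σ ∧ w * ∑ σ, g σ ≤ b := by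
    have h1 : ∑ _σ : Equiv.Perm (Fin n), a ≤ ∑ σ, g σ := Finset.sum_le_sum fun σ _ => (hg σ).1
    have h2 : ∑ σ, g σ ≤ ∑ _σ : Equiv.Perm (Fin n), b := Finset.sum_le_sum fun σ _ => (hg σ).2
    rw [Finset.sum_const, nsmul_eq_mul, Finset.card_univ] at h1 h2
    have h3 := mul_le_mul_of_nonneg_left h1 hw0
    have h4 := mul_le_mul_of_nonneg_left h2 hw0
    rw [← mul_assoc, hw1, one_mul] at h3 h4
    exact ⟨h3, h4⟩
  choose t ht using exists_weight_eq (n := n)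
  refine ⟨fun j => w * ∑ σ : Equiv.Perm (Fin n), f (t j ∘ σ), fun a b h j => avg fun σ => h _,
    fun u a b h => ?_⟩
  -- Strings of equal weight form one permutation orbit, so exchanging `s` for the chosen
  -- representative only shifts the summation variable.
  have hy (s : Fin n → Bool) : w * ∑ σ : Equiv.Perm (Fin n), f (t (weight s) ∘ σ) =
      w * ∑ σ : Equiv.Perm (Fin n), f (s ∘ σ) := by
    obtain ⟨τ, hτ⟩ := exists_perm_of_weight_eq (ht (weight s))
    congr 1
    exact Fintype.sum_equiv (Equiv.mulLeft τ) _ _ fun σ => by rw [hτ]; rfl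
  have key : ∑ s, (∏ i, u i (s i)) * (w * ∑ σ : Equiv.Perm (Fin n), f (s ∘ σ)) =
      w * ∑ σ : Equiv.Perm (Fin n), ∑ s, (∏ i, u (σ i) (s i)) * f s := by
    simp only [Finset.mul_sum]
    rw [Finset.sum_comm]
    refine Finset.sum_congr rfl fun σ _ => ?_
    refine Fintype.sum_equiv (σ.symm.arrowCongr (Equiv.refl Bool)) _ _ fun s => ?_
    have e : ∏ i, u (σ i) (s (σ i)) = ∏ i, u i (s i) :=
      Equiv.prod_comp σ fun i => u i (s i)
    rw [← e]
    simp only [Equiv.arrowCongr_apply, Equiv.coe_refl, Function.comp_apply, id, Equiv.symm_symm]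
    rw [mul_left_comm]
    rfl
  simp only [hy]
  rw [key]
  exact avg h

theorem tensorProd_wernerPair_sum (d : ℕ) (u : Fin n → Bool → ℝ) :
    ∑ s : Fin n → Bool, ((∏ i, u i (s i) : ℝ) : ℂ) • tensorProd (fun i => wernerPair d (s i)) =
      tensorProd fun i => ∑ b, (u i b : ℂ) • wernerPair d b := by
  rw [tensorProd_sum_smul (fun i b => (u i b : ℂ)) fun _ b => wernerPair d b]
  simp only [Complex.ofReal_prod]

theorem lpObjective_eq (d : ℕ) (α : ℝ) (x : Fin (n + 1) → ℝ) : lpObjective d n α x =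
    ∑ s : Fin n → Bool, (∏ i, if s i then α else 1 - α) * ((d : ℝ) ^ n * x (weight s)) := by
  rw [sum_weight_mul_prod_const (fun j => (d : ℝ) ^ n * x j) fun b => if b then α else 1 - α,
    lpObjective, Finset.mul_sum]
  refine Finset.sum_congr rfl fun j _ => ?_
  simp only [Bool.false_eq_true, if_false, if_true]
  ring

theorem sum_lpG_eq (d : ℕ) (x : Fin (n + 1) → ℝ) : ∑ j : Fin (n + 1), lpG d n j * x j =
    ∑ s : Fin n → Bool, (∏ i, if s i then ((d : ℝ) - 1) / 2 else ((d : ℝ) + 1) / 2) *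
      x (weight s) := by
  rw [sum_weight_mul_prod_const x fun b => if b then ((d : ℝ) - 1) / 2 else ((d : ℝ) + 1) / 2]
  refine Finset.sum_congr rfl fun j _ => ?_
  have e : (2 : ℝ) ^ n = 2 ^ (n - (j : ℕ)) * 2 ^ (j : ℕ) := by
    rw [← pow_add, Nat.sub_add_cancel (Nat.lt_succ_iff.mp j.2)]
  simp only [Bool.false_eq_true, if_false, if_true, lpG, div_pow, e]
  field_simp

/-- The feasible point is $d^{-n}$ times the weight average of `f`; each constraint is the value of
the code on one family of test maps. -/
theorem achievable_subset_lpObjective_image {d : ℕ} (hd : 2 ≤ d) {α : ℝ} {K : ℕ} (hK : 1 ≤ K)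
    (ns ppt : Prop) :
    achievableFidelities (tensorPow (wernerHolevo d α) n) K ns ppt ⊆
      lpObjective d n α '' lpFeasible d n K ns ppt := by
  rintro _ ⟨C, hns, hppt, rfl⟩
  have : NeZero K := ⟨by omega⟩
  have : NeZero d := ⟨by omega⟩
  have hD : (0 : ℝ) < (d : ℝ) ^ n := by have := NeZero.pos d; positivity
  set f : (Fin n → Bool) → ℝ := fun s =>
    channelFidelity (C.applyTo (tensorProd fun i => wernerPair d (s i))) with hf
  have hfu (u : Fin n → Bool → ℝ) : ∑ s, (∏ i, u i (s i)) * f s =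
      channelFidelity (C.applyTo (tensorProd fun i => ∑ b, (u i b : ℂ) • wernerPair d b)) := by
    rw [← tensorProd_wernerPair_sum, C.channelFidelity_applyTo_sum]
  obtain ⟨y, hy1, hy2⟩ := exists_weight_average f
  have hconst (u : Bool → ℝ) : ∑ s, (∏ i, u (s i)) * y (weight s) =
      channelFidelity (C.applyTo (tensorProd fun _ : Fin n => ∑ b, (u b : ℂ) • wernerPair d b)) := by
    have := hy2 (fun _ => u) _ _ fun σ => ⟨(hfu fun _ => u).ge, (hfu fun _ => u).le⟩
    exact le_antisymm this.2 this.1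
  have hinv (x : ℝ) : (d : ℝ) ^ n * (((d : ℝ) ^ n)⁻¹ * x) = x := mul_inv_cancel_left₀ hD.ne' x
  refine ⟨fun j => ((d : ℝ) ^ n)⁻¹ * y j, ⟨fun j => ?_, fun h => ?_, fun h j => ?_⟩, ?_⟩
  · have hop (s : Fin n → Bool) : IsOperation (tensorProd fun i => wernerPair d (s i)) :=
      tensorProd_isOperation (fun i => (wernerPair_isOperation hd _).1)
        fun i => (wernerPair_isOperation hd _).2
    have hj := hy1 0 1 (fun s => ⟨channelFidelity_nonneg (C.applyTo_isOperation (hop s)).1,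
      channelFidelity_le_one (C.applyTo_isOperation (hop s))⟩) j
    exact ⟨mul_nonneg (inv_nonneg.mpr hD.le) hj.1,
      mul_le_of_le_one_right (inv_nonneg.mpr hD.le) hj.2⟩
  · have e := hconst fun b => if b then ((d : ℝ) - 1) / 2 else ((d : ℝ) + 1) / 2
    have hchoi : choi (tensorProd fun _ : Fin n => traceMap (Fin d)) = 1 := by
      simp only [choi_tensorProd, choi_traceMap, tens_one]
    rw [← traceMap_eq_sum hd, C.channelFidelity_of_nonSignalling (hns h) hchoi] at e
    rw [sum_lpG_eq]
    simp only [mul_left_comm _ ((d : ℝ) ^ n)⁻¹]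
    rw [← Finset.mul_sum, e]
    simp only [Fintype.card_pi, Fintype.card_fin, Finset.prod_const, Finset.card_univ]
    push_cast
    field_simp
  · obtain ⟨t, rfl⟩ := exists_weight_eq j
    have hb (σ : Equiv.Perm (Fin n)) :
        |∑ s, (∏ i, ptCoeff d (t (σ i)) (s i)) * f s| ≤ 1 / K := by
      rw [hfu fun i => ptCoeff d (t (σ i))]
      simp only [← transposeMap_comp_eq_sum hd]
      have hV (b : Bool) : (choi (if b then LinearMap.id else complMap (Fin d))).PosSemidef ∧
          IsTracePreserving (if b then LinearMap.id else complMap (Fin d)) := by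
        cases b
        · exact ⟨choi_complMap_posSemidef, complMap_isTracePreserving (by simpa)⟩
        · refine ⟨?_, fun X => rfl⟩
          simp only [if_true, choi_id]
          exact maxEnt_posSemidef.smul (by positivity)
      refine C.abs_channelFidelity_le_of_pptPreserving (hppt h) hK
        (tensorProd_isTracePreserving fun i => ?_) ?_
      · exact fun X => (Matrix.trace_transpose _).trans ((hV _).2 X)
      -- Partial transposition of the Choi matrix undoes the transposition map, leaving the Choi
      -- matrices of the identity and `complMap`.
      · convert tens_posSemidef fun i => (hV (t (σ i))).1 using 1
        ext x y
        simp only [choi_tensorProd]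
        rfl
    have h2 := hy2 (fun i => ptCoeff d (t i)) (-(1 / K)) (1 / K) fun σ => abs_le.mp (hb σ)
    rw [sum_weight_mul_ptCoeff] at h2
    simp only [mul_left_comm _ ((d : ℝ) ^ n)⁻¹]
    rw [← Finset.mul_sum, div_eq_mul_one_div, ← mul_neg]
    exact ⟨mul_le_mul_of_nonneg_left h2.1 (inv_nonneg.mpr hD.le),
      mul_le_mul_of_nonneg_left h2.2 (inv_nonneg.mpr hD.le)⟩
  · simp only [lpObjective_eq, hinv]
    rw [hconst fun b => if b then α else 1 - α, ← wernerHolevo_eq_sum]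
    -- `tensorPow` is definitionally `tensorProd` of a constant family.
    rfl

end Converse

/-! ### Bipartite maps given by contraction with an operator -/

section Contractions

variable {q r κ : Type} [Fintype r]

/-- Bob's input is contracted with `L`, and Alice outputs the other half of `L`. -/
def contr (κ : Type) (L : Matrix (q × r) (q × r) ℂ) : SuperOp (κ × r) (q × κ) where
  toFun T := Matrix.of fun s t => ∑ b, ∑ b', L (t.1, b') (s.1, b) * T (s.2, b) (t.2, b')
  map_add' X Y := by
    ext s t
    simp [mul_add, Finset.sum_add_distrib]
  map_smul' c X := by
    ext s t
    simp [Finset.mul_sum, mul_left_comm]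

theorem contr_add (L M : Matrix (q × r) (q × r) ℂ) : contr κ (L + M) = contr κ L + contr κ M := by
  ext1 X
  ext s t
  simp [contr, add_mul, Finset.sum_add_distrib]

theorem contr_sub (L M : Matrix (q × r) (q × r) ℂ) : contr κ (L - M) = contr κ L - contr κ M := by
  ext1 X
  ext s t
  simp [contr, sub_mul, Finset.sum_sub_distrib]

theorem contr_smul (c : ℂ) (L : Matrix (q × r) (q × r) ℂ) :
    contr κ (c • L) = c • contr κ L := by
  ext1 X
  ext s t
  simp [contr, Finset.mul_sum, mul_assoc]

theorem contr_isCompletelyPositive [Fintype q] [Fintype κ] {L : Matrix (q × r) (q × r) ℂ}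
    (hL : L.PosSemidef) : IsCompletelyPositive (contr κ L) := fun k X hX => by
  have h := (link_posSemidef (hL.transpose.submatrix (Prod.swap : r × q → q × r))
    (hX.submatrix fun x : r × (κ × Fin k) => ((x.2.1, x.1), x.2.2))).submatrix
      fun x : (q × κ) × Fin k => (x.1.1, (x.1.2, x.2))
  exact h

theorem actSnd_add (a : Type) (N M : SuperOp q κ) : actSnd a (N + M) = actSnd a N + actSnd a M :=
  rfl

theorem actSnd_sub (a : Type) (N M : SuperOp q κ) : actSnd a (N - M) = actSnd a N - actSnd a M :=
  rfl

theorem actSnd_smul (a : Type) (c : ℂ) (N : SuperOp q κ) : actSnd a (c • N) = c • actSnd a N :=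
  rfl

theorem actSnd_comp {u : Type} (a : Type) (N : SuperOp κ u) (M : SuperOp q κ) :
    actSnd a (N ∘ₗ M) = actSnd a N ∘ₗ actSnd a M :=
  rfl

/-- The partial transpose of a bipartite operator. -/
def ptranspose (L : Matrix (q × r) (q × r) ℂ) : Matrix (q × r) (q × r) ℂ :=
  Matrix.of fun s t => L (s.1, t.2) (t.1, s.2)

/-- Turns the transposition of Bob's input, which appears in the PPT condition, into a partial
transpose of the measured effect. -/
theorem contr_comp_transpose (L : Matrix (q × r) (q × r) ℂ) :
    contr κ L ∘ₗ actSnd κ (transposeMap r) = contr κ (ptranspose L) := by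
  ext1 X
  ext s t
  simp only [contr, actSnd, transposeMap_apply, ptranspose, LinearMap.comp_apply,
    LinearMap.coe_mk, AddHom.coe_mk, Matrix.of_apply, Matrix.transpose_apply]
  exact Finset.sum_comm

/-- The transposition of Bob's ancilla commutes with $Z\otimes\mathrm{id}$, so only the
transpositions of his input and output have to be absorbed into $Z$. -/
theorem pptPreserving_of_isCompletelyPositive {a b a' b' : Type} [Fintype a] [Fintype b]
    {Z : SuperOp (a × b) (a' × b')}
    (h : IsCompletelyPositive (actSnd a' (transposeMap b') ∘ₗ Z ∘ₗ actSnd a (transposeMap b))) :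
    PPTPreserving Z := by
  intro at' bt _ _ ρ _ hρ
  exact h.posSemidef (at' × bt) hρ

end Contractions

/-! ### The measurement code and its properties -/

section MeasurementCode

variable {q r : Type} [Fintype q] [Fintype r] [DecidableEq q] {K : ℕ}

/-- Alice keeps her input and appends a maximally entangled state of `q` with a copy of `q`. -/
def entEnc (q κ : Type) [Fintype q] [DecidableEq q] : SuperOp κ (q × (κ × q)) where
  toFun X := Matrix.of fun s t =>
    if s.1 = s.2.2 ∧ t.1 = t.2.2 then (Fintype.card q : ℂ)⁻¹ * X s.2.1 t.2.1 else 0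
  map_add' X Y := by
    ext s t
    simp only [Matrix.of_apply, Matrix.add_apply]
    split_ifs <;> ring
  map_smul' c X := by
    ext s t
    simp only [Matrix.of_apply, Matrix.smul_apply, smul_eq_mul, RingHom.id_apply]
    split_ifs <;> ring

theorem entEnc_isOperation [Nonempty q] {κ : Type} [Fintype κ] [DecidableEq κ] :
    IsOperation (entEnc q κ) := by
  constructor
  · intro k X hX
    have h := (maxEnt_posSemidef (q := q)).kronecker hX
    have e : actFst (entEnc q κ) (Fin k) X =
        (Matrix.kroneckerMap (fun x y => x * y) (maxEnt q) X).submatrix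
          (fun x => ((x.1.1, x.1.2.2), (x.1.2.1, x.2)))
          fun x => ((x.1.1, x.1.2.2), (x.1.2.1, x.2)) := by
      ext s t
      simp only [actFst, entEnc, LinearMap.coe_mk, AddHom.coe_mk, Matrix.of_apply,
        Matrix.submatrix_apply, Matrix.kroneckerMap_apply, maxEnt_apply, ite_mul, zero_mul]
    rw [e]
    exact h.submatrix _
  · intro X
    have hq : (Fintype.card q : ℂ) ≠ 0 := by simp
    simp [Matrix.trace, entEnc, Fintype.sum_prod_type, ite_and]
    rw [← Finset.mul_sum, mul_inv_cancel_left₀ hq]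

/-- The part of the decoder that keeps the message when the effect `L` is measured on the channel
output and the copy of the channel input. -/
def effectDec (κ : Type) (L : Matrix (q × r) (q × r) ℂ) : SuperOp (r × (κ × q)) κ where
  toFun Y := Matrix.of fun s t => ∑ p : q × r, ∑ p' : q × r,
    L p' p * Y (p.2, (s, p.1)) (p'.2, (t, p'.1))
  map_add' X Y := by
    ext s t
    simp [mul_add, Finset.sum_add_distrib]
  map_smul' c X := by
    ext s t
    simp [Finset.mul_sum, mul_left_comm]

omit [DecidableEq q] in
theorem effectDec_isCompletelyPositive {κ : Type} [Fintype κ] {L : Matrix (q × r) (q × r) ℂ}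
    (hL : L.PosSemidef) : IsCompletelyPositive (effectDec κ L) := fun k X hX => by
  have h := (link_posSemidef (e := Unit)
    (hL.transpose.submatrix fun x : (q × r) × Unit => x.1)
    (hX.submatrix fun x : (q × r) × (κ × Fin k) => ((x.1.2, (x.2.1, x.1.1)), x.2.2))).submatrix
      fun x : κ × Fin k => ((), x)
  exact h

variable [DecidableEq r]

theorem trace_effectDec {κ : Type} [Fintype κ] (L : Matrix (q × r) (q × r) ℂ)
    (Y : Matrix (r × (κ × q)) (r × (κ × q)) ℂ) :
    (effectDec κ L Y).trace + (effectDec κ (1 - L) Y).trace = Y.trace := by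
  have h : (effectDec κ (1 : Matrix (q × r) (q × r) ℂ) Y).trace = Y.trace := by
    simp only [Matrix.trace, effectDec, LinearMap.coe_mk, AddHom.coe_mk, Matrix.of_apply,
      Matrix.diag_apply, Matrix.one_apply, ite_mul, one_mul, zero_mul, Finset.sum_ite_eq',
      Finset.mem_univ, if_true, Fintype.sum_prod_type]
    rw [Finset.sum_comm]
    conv_lhs => enter [2, x]; rw [Finset.sum_comm]
    rw [Finset.sum_comm]
    refine Finset.sum_congr rfl fun b _ => Finset.sum_comm
  rw [← h, ← Matrix.trace_add]
  congr 1
  ext s t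
  simp [effectDec, sub_mul, Finset.sum_sub_distrib]

theorem complMap_eq_zero {κ : Type} [Fintype κ] [DecidableEq κ] (h : Fintype.card κ = 1) :
    complMap κ = 0 := by
  simp [complMap, h]

/-- Alice sends half of a maximally entangled state through the channel and forwards the message
and the other half; Bob measures the effect `L`, and applies `complMap` to the message if he does
not find it. -/
def measurementCode [Nonempty q] (L : Matrix (q × r) (q × r) ℂ) (h0 : L.PosSemidef)
    (h1 : (1 - L).PosSemidef) (hK : 1 ≤ K) (hL : 2 ≤ K ∨ L = 1) : ForwardAssistedCode q r K where
  Q := Fin K × q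
  R := Fin K × q
  enc := entEnc q (Fin K)
  side := LinearMap.id
  dec := effectDec (Fin K) L + complMap (Fin K) ∘ₗ effectDec (Fin K) (1 - L)
  enc_isOperation := entEnc_isOperation
  side_isOperation := ⟨isCompletelyPositive_id, fun _ => rfl⟩
  dec_isOperation := by
    have : Nonempty (Fin K) := ⟨⟨0, hK⟩⟩
    refine ⟨(effectDec_isCompletelyPositive h0).add
      ((isCompletelyPositive_of_choi choi_complMap_posSemidef).comp
        (effectDec_isCompletelyPositive h1)), fun Y => ?_⟩
    rw [LinearMap.add_apply, Matrix.trace_add, LinearMap.comp_apply, ← trace_effectDec L Y]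
    congr 1
    -- For $K=1$ `complMap` is zero and would lose the trace of the second branch; that branch must
    -- vanish, whence the alternative $L=1$.
    rcases hL with h | rfl
    · exact complMap_isTracePreserving (by simpa) _
    · have : effectDec (Fin K) (1 - 1 : Matrix (q × r) (q × r) ℂ) Y = 0 := by
        ext s t
        simp [effectDec]
      rw [this, map_zero]

variable [Nonempty q] {L : Matrix (q × r) (q × r) ℂ} (h0 : L.PosSemidef)
    (h1 : (1 - L).PosSemidef) (hK : 1 ≤ K) (hL : 2 ≤ K ∨ L = 1)

theorem measurementCode_bipartite : (measurementCode L h0 h1 hK hL).bipartite =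
    (Fintype.card q : ℂ)⁻¹ • (contr (Fin K) L +
      actSnd q (complMap (Fin K)) ∘ₗ contr (Fin K) (1 - L)) := by
  ext1 T
  have key (L : Matrix (q × r) (q × r) ℂ) (a a' : q) :
      effectDec (Fin K) L (Matrix.of fun x y => entEnc q (Fin K)
        (Matrix.of fun i j => T (i, x.1) (j, y.1)) (a, x.2) (a', y.2)) =
      (Fintype.card q : ℂ)⁻¹ •
        Matrix.of fun s t => contr (Fin K) L T (a, s) (a', t) := by
    ext s t
    simp only [effectDec, entEnc, contr, LinearMap.coe_mk, AddHom.coe_mk, Matrix.of_apply,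
      Fintype.sum_prod_type, ite_and, Matrix.smul_apply, smul_eq_mul, mul_ite, mul_zero,
      Finset.sum_ite_irrel, Finset.sum_const_zero]
    simp only [Finset.sum_ite_eq, Finset.mem_univ, if_true, Finset.mul_sum]
    simp [mul_left_comm]
  ext ⟨a, s⟩ ⟨a', t⟩
  change (effectDec (Fin K) L + complMap (Fin K) ∘ₗ effectDec (Fin K) (1 - L) :
      SuperOp (r × (Fin K × q)) (Fin K))
    (Matrix.of fun x y => entEnc q (Fin K)
        (Matrix.of fun i j => T (i, x.1) (j, y.1)) (a, x.2) (a', y.2)) s t = _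
  rw [LinearMap.add_apply, LinearMap.comp_apply, key, key, map_smul, ← smul_add]
  rfl

/-- The code with `N` is a combination of the identity, with weight
$\mathrm{Tr}(\mathrm{choi}(N)L)/\dim q$, and of `complMap`, whose Choi matrix is a multiple of
$1-\phi$ and so contributes no fidelity. -/
theorem measurementCode_channelFidelity (N : SuperOp q r) :
    channelFidelity ((measurementCode L h0 h1 hK hL).applyTo N) =
      ((Fintype.card q : ℂ)⁻¹ * (choi N * L).trace).re := by
  have e (L : Matrix (q × r) (q × r) ℂ) (X : Matrix (Fin K) (Fin K) ℂ) (a a' : q) (b b' : r) :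
      (Matrix.of fun s t => contr (Fin K) L
        (Matrix.of fun x y => X x.1 y.1 * Matrix.single b b' (1 : ℂ) x.2 y.2) (a, s) (a', t)) =
        L (a', b') (a, b) • X := by
    ext s t
    simp [contr, Matrix.single_apply, ite_and, Finset.sum_ite_irrel]
  have h : (measurementCode L h0 h1 hK hL).applyTo N =
      ((Fintype.card q : ℂ)⁻¹ * (choi N * L).trace) • LinearMap.id +
        ((Fintype.card q : ℂ)⁻¹ * (choi N * (1 - L)).trace) • complMap (Fin K) := by
    ext1 X
    ext s t
    rw [ForwardAssistedCode.applyTo_apply, measurementCode_bipartite]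
    have e1 (a a' : q) (b b' : r) : ((Fintype.card q : ℂ)⁻¹ • (contr (Fin K) L +
      actSnd q (complMap (Fin K)) ∘ₗ contr (Fin K) (1 - L)) : SuperOp (Fin K × r) (q × Fin K))
        (Matrix.of fun x y => X x.1 y.1 * Matrix.single b b' (1 : ℂ) x.2 y.2) (a, s) (a', t) =
        (Fintype.card q : ℂ)⁻¹ * (L (a', b') (a, b) * X s t +
          (1 - L) (a', b') (a, b) * complMap (Fin K) X s t) := by
      rw [LinearMap.smul_apply, Matrix.smul_apply, LinearMap.add_apply, Matrix.add_apply,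
        LinearMap.comp_apply, smul_eq_mul]
      congr 2
      · exact congrFun (congrFun (e L X a a' b b') s) t
      · change complMap (Fin K) (Matrix.of fun i j => contr (Fin K) (1 - L)
          (Matrix.of fun x y => X x.1 y.1 * Matrix.single b b' (1 : ℂ) x.2 y.2) (a, i) (a', j))
            s t = _
        rw [e, map_smul]
        rfl
    simp only [e1]
    simp only [Matrix.trace, Matrix.diag_apply, Matrix.mul_apply, Fintype.sum_prod_type,
      LinearMap.add_apply, LinearMap.smul_apply, Matrix.add_apply, Matrix.smul_apply,
      LinearMap.id_apply, smul_eq_mul, mul_assoc, Finset.mul_sum, Finset.sum_mul]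
    simp only [← Finset.sum_add_distrib]
    refine Finset.sum_congr rfl fun a _ => ?_
    conv_rhs => rw [Finset.sum_comm]
    refine Finset.sum_congr rfl fun a' _ => Finset.sum_congr rfl fun b _ =>
      Finset.sum_congr rfl fun b' _ => ?_
    ring
  have hK' : (K : ℂ) ≠ 0 := by
    have : K ≠ 0 := by omega
    exact_mod_cast this
  have hid : ∑ i, ∑ j, choi (LinearMap.id : SuperOp (Fin K) (Fin K)) (i, i) (j, j) =
      (K : ℂ) ^ 2 := by
    simp [choi, sq]
  have htr : ∑ i, ∑ j, choi (traceMap (Fin K)) (i, i) (j, j) = (K : ℂ) := by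
    simp [choi_traceMap, Matrix.one_apply]
  have hcompl : ∑ i, ∑ j, choi (complMap (Fin K)) (i, i) (j, j) = 0 := by
    simp only [complMap, choi_smul, choi_sub, Matrix.smul_apply, Matrix.sub_apply, smul_eq_mul,
      ← Finset.mul_sum, Finset.sum_sub_distrib, hid, htr, Fintype.card_fin]
    ring
  rw [h, channelFidelity_eq]
  simp only [choi_add, choi_smul, Matrix.add_apply, Matrix.smul_apply, smul_eq_mul,
    Finset.sum_add_distrib, ← Finset.mul_sum, hid, hcompl, mul_zero, add_zero, Fintype.card_fin]
  congr 1
  field_simp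

/-- The marginal condition makes Bob find `L` with probability $K^{-2}$ whatever his input. Mixing
the identity and `complMap` with weights $K^{-2}$ and $1-K^{-2}$ depolarises completely, so his
marginal output is $\mathrm{Tr}Y\cdot\mathbb 1/K$. -/
theorem measurementCode_nonSignalling
    (h : ∀ b b' : r, ∑ a, L (a, b') (a, b) =
      if b = b' then (Fintype.card q : ℂ) / (K : ℂ) ^ 2 else 0) :
    NonSignallingAliceToBob (measurementCode L h0 h1 hK hL).bipartite := by
  have hK' : (K : ℂ) ≠ 0 := by
    have : K ≠ 0 := by omega
    exact_mod_cast this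
  have hq : (Fintype.card q : ℂ) ≠ 0 := by simp
  let Z : SuperOp r (Fin K) :=
    (K : ℂ)⁻¹ • (Matrix.traceLinearMap r ℂ ℂ).smulRight (1 : Matrix (Fin K) (Fin K) ℂ)
  have hZ (Y : Matrix r r ℂ) : Z Y = (K : ℂ)⁻¹ • Y.trace • 1 := rfl
  refine ⟨Z, ⟨?_, fun Y => ?_⟩, ?_⟩
  · apply isCompletelyPositive_of_choi
    have : choi Z = (K : ℂ)⁻¹ • 1 := by
      ext ⟨a, b⟩ ⟨c, e⟩
      by_cases hac : a = c
      · subst hac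
        simp [choi, hZ, Matrix.one_apply]
      · simp [choi, hZ, hac, Matrix.trace_single_eq_of_ne]
    rw [this]
    exact Matrix.PosSemidef.one.smul (by positivity)
  · rw [hZ]
    simp only [Matrix.trace_smul, Matrix.trace_one, Fintype.card_fin, smul_eq_mul]
    field_simp
  · ext1 T
    set Y : Matrix (Fin K) (Fin K) ℂ := Matrix.of fun s t => ∑ b, T (s, b) (t, b) with hY
    have hYtr : (traceFst (Fin K) r T).trace = Y.trace := by
      simp only [Matrix.trace, traceFst, hY, LinearMap.coe_mk, AddHom.coe_mk, Matrix.of_apply,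
        Matrix.diag_apply]
      exact Finset.sum_comm
    have e (L : Matrix (q × r) (q × r) ℂ) (c : ℂ)
        (h : ∀ b b' : r, ∑ a, L (a, b') (a, b) = if b = b' then c else 0) :
        (∑ a, Matrix.of fun s t => contr (Fin K) L T (a, s) (a, t)) = c • Y := by
      ext s t
      simp only [contr, LinearMap.coe_mk, AddHom.coe_mk, Matrix.of_apply, Matrix.sum_apply,
        Matrix.smul_apply, hY, smul_eq_mul, Finset.mul_sum]
      rw [Finset.sum_comm]
      refine Finset.sum_congr rfl fun b _ => ?_
      rw [Finset.sum_comm]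
      simp [← Finset.sum_mul, h]
    have h' (b b' : r) : ∑ a, (1 - L) (a, b') (a, b) =
        if b = b' then (Fintype.card q : ℂ) - (Fintype.card q : ℂ) / (K : ℂ) ^ 2 else 0 := by
      simp only [Matrix.sub_apply, Finset.sum_sub_distrib, h]
      by_cases hb : b = b'
      · simp [hb, Matrix.one_apply]
      · simp [hb, Ne.symm hb]
    have e3 : traceFst q (Fin K) ((measurementCode L h0 h1 hK hL).bipartite T) =
        (Fintype.card q : ℂ)⁻¹ • (((Fintype.card q : ℂ) / (K : ℂ) ^ 2) • Y +
          ((Fintype.card q : ℂ) - (Fintype.card q : ℂ) / (K : ℂ) ^ 2) •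
            complMap (Fin K) Y) := by
      rw [measurementCode_bipartite, LinearMap.smul_apply, map_smul, LinearMap.add_apply, map_add,
        LinearMap.comp_apply, ← e L _ h, ← map_smul, ← e (1 - L) _ h', map_sum]
      congr 2
      · ext s t
        simp [traceFst, Matrix.sum_apply]
      · ext s t
        simp [traceFst, Matrix.sum_apply, actSnd]
    rw [LinearMap.comp_apply, LinearMap.comp_apply, e3, hZ, hYtr]
    rcases hK.lt_or_eq with hK2 | rfl
    · have hK3 : ((K : ℂ) ^ 2 - 1) ≠ 0 := by
        have : ((K : ℝ) ^ 2 - 1) ≠ 0 := by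
          have : (2 : ℝ) ≤ K := by exact_mod_cast hK2
          nlinarith
        exact_mod_cast this
      simp only [complMap, LinearMap.smul_apply, LinearMap.sub_apply, traceMap_apply,
        LinearMap.id_apply, Fintype.card_fin]
      push_cast
      ext s t
      simp only [Matrix.smul_apply, Matrix.add_apply, Matrix.sub_apply, smul_eq_mul]
      field_simp
      ring
    -- For $K=1$ only the first term is left, and a $1\times1$ matrix is determined by its trace.
    · rw [complMap_eq_zero (by simp)]
      ext s t
      rw [Subsingleton.elim s 0, Subsingleton.elim t 0]
      simp [Matrix.trace]

/-- Let $T_\pm(X)=\mathbb 1\,\mathrm{Tr}X\pm X^{\mathrm T}$, both completely positive. For $K\ge2$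
the transposed bipartite map is, up to the factor $1/\dim q$, the sum over both signs of
$\frac1{2(K\pm1)}T_\pm$ after contraction with $1\pm KL^\Gamma$. -/
theorem measurementCode_pptPreserving (h2 : (1 + (K : ℂ) • ptranspose L).PosSemidef)
    (h3 : (1 - (K : ℂ) • ptranspose L).PosSemidef) :
    PPTPreserving (measurementCode L h0 h1 hK hL).bipartite := by
  apply pptPreserving_of_isCompletelyPositive
  have hpt1 : ptranspose (1 : Matrix (q × r) (q × r) ℂ) = 1 := by
    ext s t
    simp only [ptranspose, Matrix.of_apply, Matrix.one_apply, Prod.ext_iff, eq_comm]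
  have hpt : ptranspose (1 - L) = 1 - ptranspose L := by
    conv_rhs => rw [← hpt1]
    rfl
  have e : actSnd q (transposeMap (Fin K)) ∘ₗ (measurementCode L h0 h1 hK hL).bipartite ∘ₗ
      actSnd (Fin K) (transposeMap r) = (Fintype.card q : ℂ)⁻¹ •
        (actSnd q (transposeMap (Fin K)) ∘ₗ contr (Fin K) (ptranspose L) +
          actSnd q (transposeMap (Fin K) ∘ₗ complMap (Fin K)) ∘ₗ
            contr (Fin K) (1 - ptranspose L)) := by
    rw [measurementCode_bipartite, ← hpt, ← contr_comp_transpose, ← contr_comp_transpose,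
      actSnd_comp]
    simp only [LinearMap.smul_comp, LinearMap.comp_smul, LinearMap.add_comp, LinearMap.comp_add,
      LinearMap.comp_assoc]
  rw [e]
  have hq : (Fintype.card q : ℂ)⁻¹ = (((Fintype.card q : ℝ)⁻¹ : ℝ) : ℂ) := by push_cast; rfl
  rw [hq]
  refine IsCompletelyPositive.smul ?_ (by positivity)
  rcases hK.lt_or_eq with hK2 | rfl
  · have hK3 : (2 : ℝ) ≤ K := by exact_mod_cast hK2
    have c1 : IsCompletelyPositive (traceMap (Fin K) + transposeMap (Fin K)) :=
      isCompletelyPositive_of_choi (by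
        rw [choi_add, choi_traceMap, choi_transposeMap]
        exact one_add_swapOp_posSemidef)
    have c2 : IsCompletelyPositive (traceMap (Fin K) - transposeMap (Fin K)) :=
      isCompletelyPositive_of_choi (by
        rw [choi_sub, choi_traceMap, choi_transposeMap]
        exact one_sub_swapOp_posSemidef)
    have c3 := ((c1.actSnd q).comp (contr_isCompletelyPositive (κ := Fin K) h2)).smul
      (a := (2 * ((K : ℝ) + 1))⁻¹) (by positivity)
    have c4 := ((c2.actSnd q).comp (contr_isCompletelyPositive (κ := Fin K) h3)).smul
      (a := (2 * ((K : ℝ) - 1))⁻¹) (inv_nonneg.mpr (by linarith))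
    have hR : transposeMap (Fin K) ∘ₗ complMap (Fin K) = ((((K : ℝ) ^ 2 - 1)⁻¹ : ℝ) : ℂ) •
        ((K : ℂ) • traceMap (Fin K) - transposeMap (Fin K)) := by
      ext1 X
      simp [complMap, transposeMap_apply, traceMap_apply]
    convert c3.add c4 using 1
    have k1 : ((K : ℂ) ^ 2 - 1) ≠ 0 := by
      have : ((K : ℝ) ^ 2 - 1) ≠ 0 := by nlinarith
      exact_mod_cast this
    have k2 : ((K : ℂ) - 1) ≠ 0 := by
      have : ((K : ℝ) - 1) ≠ 0 := by linarith
      exact_mod_cast this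
    have k3 : ((K : ℂ) + 1) ≠ 0 := by
      have : ((K : ℝ) + 1) ≠ 0 := by linarith
      exact_mod_cast this
    rw [hR]
    simp only [actSnd_add, actSnd_sub, actSnd_smul, contr_add, contr_sub, contr_smul,
      LinearMap.add_comp, LinearMap.sub_comp, LinearMap.smul_comp, LinearMap.comp_add,
      LinearMap.comp_sub, LinearMap.comp_smul]
    push_cast
    rw [show (2 * ((K : ℂ) + 1))⁻¹ = ((K : ℂ) ^ 2 - 1)⁻¹ * (((K : ℂ) - 1) / 2) by
      field_simp; ring, show (2 * ((K : ℂ) - 1))⁻¹ = ((K : ℂ) ^ 2 - 1)⁻¹ * (((K : ℂ) + 1) / 2) by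
      field_simp; ring]
    generalize hA : actSnd q (transposeMap (Fin K)) ∘ₗ contr (Fin K) (ptranspose L) = A
    -- The one term without the scalar $(K^2-1)^{-1}$ is given it, so that `module` can treat the
    -- inverse as an atom.
    have hA1 : A = (((K : ℂ) ^ 2 - 1)⁻¹ * ((K : ℂ) ^ 2 - 1)) • A := by
      rw [inv_mul_cancel₀ k1, one_smul]
    conv_lhs => enter [1]; rw [hA1]
    module
  · have hl : L = 1 := by
      rcases hL with h | h
      · omega
      · exact h
    have ht : transposeMap (Fin 1) = LinearMap.id := by
      ext1 X
      ext s t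
      rw [Subsingleton.elim s 0, Subsingleton.elim t 0]
      rfl
    rw [complMap_eq_zero (by simp), hl, hpt1, ht]
    have := (isCompletelyPositive_id.actSnd q).comp
      (contr_isCompletelyPositive (κ := Fin 1) (Matrix.PosSemidef.one (n := q × r) (R := ℂ)))
    convert this using 1
    ext1 X
    ext s t
    simp [actSnd]

end MeasurementCode

/-! ### Lower bound: every feasible point needed is reached by a code -/

section OptimalCode

variable {n d K : ℕ}

/-- The symmetric (`false`) and the antisymmetric (`true`) projection. -/
def symProj (d : ℕ) (b : Bool) : Matrix (Fin d × Fin d) (Fin d × Fin d) ℂ :=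
  (2 : ℂ)⁻¹ • if b then 1 - swapOp (Fin d) else 1 + swapOp (Fin d)

theorem symProj_posSemidef (b : Bool) : (symProj d b).PosSemidef := by
  have h : (0 : ℂ) ≤ 2⁻¹ := by positivity
  cases b
  · exact one_add_swapOp_posSemidef.smul h
  · exact one_sub_swapOp_posSemidef.smul h

/-- The projections onto the orthogonal complement of the maximally entangled state (`false`) and
onto it (`true`). -/
def entProj (d : ℕ) (b : Bool) : Matrix (Fin d × Fin d) (Fin d × Fin d) ℂ :=
  if b then maxEnt (Fin d) else 1 - maxEnt (Fin d)

theorem entProj_posSemidef (b : Bool) : (entProj d b).PosSemidef := by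
  cases b
  · exact one_sub_maxEnt_posSemidef
  · exact maxEnt_posSemidef

/-- The partial transpose of the swap is $d\phi$, so $\tfrac12(1\pm d\phi)$ is to be split along
$\phi$ and $1-\phi$. -/
theorem ptranspose_symProj (b : Bool) :
    ptranspose (symProj d b) = ∑ t, (ptCoeff d t b : ℂ) • entProj d t := by
  have h1 : ptranspose (1 : Matrix (Fin d × Fin d) (Fin d × Fin d) ℂ) = 1 := by
    ext s t
    simp only [ptranspose, Matrix.of_apply, Matrix.one_apply, Prod.ext_iff, eq_comm]
  have h2 : ptranspose (swapOp (Fin d)) = (d : ℂ) • maxEnt (Fin d) := by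
    ext s t
    have : NeZero d := ⟨by rintro rfl; exact s.1.elim0⟩
    have hd : (d : ℂ) ≠ 0 := by exact_mod_cast NeZero.ne d
    simp [ptranspose, swapOp, maxEnt_apply, hd, eq_comm]
  have h3 : ptranspose (symProj d b) =
      (2 : ℂ)⁻¹ • if b then ptranspose 1 - ptranspose (swapOp (Fin d))
        else ptranspose 1 + ptranspose (swapOp (Fin d)) := by
    cases b <;> rfl
  rw [h3, h1, h2]
  cases b
  · simp only [Bool.false_eq_true, if_false, Fintype.sum_bool, entProj, if_true, ptCoeff]
    push_cast
    module
  · simp only [Bool.false_eq_true, if_false, Fintype.sum_bool, entProj, if_true, ptCoeff]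
    push_cast
    module

theorem sum_symProj (b : Bool) (i j : Fin d) : ∑ a, symProj d b (a, j) (a, i) =
    if i = j then (((if b then ((d : ℝ) - 1) / 2 else ((d : ℝ) + 1) / 2 : ℝ)) : ℂ) else 0 := by
  by_cases h : i = j
  · subst h
    cases b
    · simp [symProj, swapOp, ite_and, Finset.sum_add_distrib, ← Finset.mul_sum]
      ring
    · simp [symProj, swapOp, ite_and, ← Finset.mul_sum]
      ring
  · cases b <;> simp [symProj, swapOp, h, Ne.symm h, ite_and]

/-- The Choi matrices of the extreme channels are $2P_b/(d\pm1)$, with orthogonal projections $P_b$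
of rank $d(d\pm1)/2$. -/
theorem trace_choi_wernerHolevo_mul_symProj (hd : 2 ≤ d) (α : ℝ) (b : Bool) :
    (choi (wernerHolevo d α) * symProj d b).trace =
      (((d : ℝ) * if b then α else 1 - α : ℝ) : ℂ) := by
  have h2 : ((d : ℂ) - 1) ≠ 0 := by
    have : ((d : ℝ) - 1) ≠ 0 := by
      have : (2 : ℝ) ≤ d := by exact_mod_cast hd
      linarith
    exact_mod_cast this
  have h3 : ((d : ℂ) + 1) ≠ 0 := by exact_mod_cast Nat.succ_ne_zero d
  have hs : (swapOp (Fin d)).trace = (d : ℂ) := by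
    simp only [Matrix.trace, swapOp, Matrix.diag_apply, Matrix.of_apply, Fintype.sum_prod_type]
    simp [eq_comm]
  have h1 : (1 : Matrix (Fin d × Fin d) (Fin d × Fin d) ℂ).trace = (d : ℂ) * d := by simp
  rw [wernerHolevo, choi_add, choi_smul, choi_smul, wernerHolevoZero_eq, wernerHolevoOne_eq,
    choi_smul, choi_smul, choi_add, choi_sub, choi_traceMap, choi_transposeMap]
  cases b
  · simp only [symProj, Bool.false_eq_true, if_false, Matrix.add_mul, Matrix.smul_mul,
      Matrix.mul_smul, Matrix.sub_mul, Matrix.mul_add, swapOp_mul_self, one_mul, mul_one,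
      Matrix.trace_add, Matrix.trace_smul, Matrix.trace_sub, hs, h1, smul_eq_mul]
    push_cast
    field_simp
    ring
  · simp only [symProj, if_true, Matrix.add_mul, Matrix.smul_mul,
      Matrix.mul_smul, Matrix.sub_mul, Matrix.mul_sub, swapOp_mul_self, one_mul, mul_one,
      Matrix.trace_add, Matrix.trace_smul, Matrix.trace_sub, hs, h1, smul_eq_mul, Matrix.add_mul]
    push_cast
    field_simp
    ring

/-- The effect with weights `z` on the tensor products of symmetric and antisymmetric
projections. -/
def symEffect (d : ℕ) (z : Fin (n + 1) → ℝ) :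
    Matrix ((Fin n → Fin d) × (Fin n → Fin d)) ((Fin n → Fin d) × (Fin n → Fin d)) ℂ :=
  ∑ s : Fin n → Bool, (z (weight s) : ℂ) • tens fun i => symProj d (s i)

theorem symEffect_one : symEffect d (fun _ : Fin (n + 1) => 1) = 1 := by
  have h := tens_sum_smul (fun (_ : Fin n) _ => (1 : ℂ)) fun _ b => symProj d b
  have h1 : ∑ b, (1 : ℂ) • symProj d b = 1 := by
    simp only [Fintype.sum_bool, symProj, Bool.false_eq_true, if_false, if_true]
    module
  simp only [h1, tens_one, Finset.prod_const_one] at h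
  rw [symEffect, h]
  simp

theorem symEffect_sub (z w : Fin (n + 1) → ℝ) :
    symEffect d (fun j => z j - w j) = symEffect d z - symEffect d w := by
  simp only [symEffect, Complex.ofReal_sub, sub_smul, Finset.sum_sub_distrib]

theorem symEffect_posSemidef {z : Fin (n + 1) → ℝ} (hz : ∀ j, 0 ≤ z j) :
    (symEffect d z).PosSemidef :=
  Matrix.posSemidef_sum _ fun s _ => (tens_posSemidef fun i => symProj_posSemidef (s i)).smul
    (by exact_mod_cast hz (weight s))

theorem sum_symEffect (z : Fin (n + 1) → ℝ) (f g : Fin n → Fin d) :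
    ∑ a, symEffect d z (a, g) (a, f) =
      if f = g then ((∑ j : Fin (n + 1), lpG d n j * z j : ℝ) : ℂ) else 0 := by
  have h (s : Fin n → Bool) : ∑ a : Fin n → Fin d,
      tens (fun i => symProj d (s i)) (a, g) (a, f) = if f = g then
        ((∏ i, (if s i then ((d : ℝ) - 1) / 2 else ((d : ℝ) + 1) / 2) : ℝ) : ℂ) else 0 := by
    simp only [tens, Matrix.of_apply]
    rw [sum_prod_eq_prod_sum fun i a => symProj d (s i) (a, g i) (a, f i)]
    simp only [sum_symProj, Finset.prod_ite_zero, Finset.mem_univ, forall_true_left, funext_iff]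
    push_cast
    rfl
  simp only [symEffect, Matrix.sum_apply, Matrix.smul_apply, smul_eq_mul]
  rw [Finset.sum_comm]
  simp only [← Finset.mul_sum, h, sum_lpG_eq]
  split_ifs
  · push_cast
    exact Finset.sum_congr rfl fun s _ => mul_comm _ _
  · simp

/-- Diagonalises the partial transpose: the rows of $M$ give its eigenvalues, so the PPTp
constraints bound it by $\pm1/K$. -/
theorem ptranspose_symEffect (z : Fin (n + 1) → ℝ) : ptranspose (symEffect d z) =
    ∑ t : Fin n → Bool, ((∑ j : Fin (n + 1), lpM d n (weight t) j * z j : ℝ) : ℂ) •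
      tens fun i => entProj d (t i) := by
  have h1 : ptranspose (symEffect d z) =
      ∑ s : Fin n → Bool, (z (weight s) : ℂ) • tens fun i => ptranspose (symProj d (s i)) := by
    ext x y
    simp only [ptranspose, symEffect, Matrix.of_apply, Matrix.sum_apply, Matrix.smul_apply]
    rfl
  rw [h1]
  simp only [ptranspose_symProj, ← sum_weight_mul_ptCoeff,
    fun s : Fin n → Bool => tens_sum_smul (fun i t => (ptCoeff d t (s i) : ℂ))
      fun _ t => entProj d t]
  simp only [Finset.smul_sum, Complex.ofReal_sum, Finset.sum_smul, smul_smul]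
  rw [Finset.sum_comm]
  refine Finset.sum_congr rfl fun t _ => Finset.sum_congr rfl fun s _ => ?_
  push_cast
  rw [mul_comm]

theorem one_add_ptranspose_symEffect_posSemidef {z : Fin (n + 1) → ℝ} {c : ℝ}
    (h : ∀ i : Fin (n + 1), 0 ≤ 1 + c * ∑ j : Fin (n + 1), lpM d n i j * z j) :
    (1 + (c : ℂ) • ptranspose (symEffect d z)).PosSemidef := by
  have h1 : (1 : Matrix ((Fin n → Fin d) × (Fin n → Fin d)) _ ℂ) =
      ∑ t : Fin n → Bool, tens fun i => entProj d (t i) := by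
    have h := tens_sum_smul (fun (_ : Fin n) _ => (1 : ℂ)) fun _ b => entProj d b
    have h1 : ∑ b, entProj d b = 1 := by
      simp [entProj]
    simp only [one_smul, h1, tens_one, Finset.prod_const_one] at h
    exact h
  have h2 : 1 + (c : ℂ) • ptranspose (symEffect d z) = ∑ t : Fin n → Bool,
      ((1 + c * ∑ j : Fin (n + 1), lpM d n (weight t) j * z j : ℝ) : ℂ) •
        tens fun i => entProj d (t i) := by
    rw [ptranspose_symEffect, h1, Finset.smul_sum, ← Finset.sum_add_distrib]
    refine Finset.sum_congr rfl fun t _ => ?_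
    rw [Complex.ofReal_add, Complex.ofReal_mul, Complex.ofReal_one, add_smul, one_smul, mul_smul]
  rw [h2]
  exact Matrix.posSemidef_sum _ fun t _ => (tens_posSemidef fun i => entProj_posSemidef (t i)).smul
    (by exact_mod_cast h (weight t))

theorem trace_choi_mul_symEffect (hd : 2 ≤ d) (α : ℝ) (x : Fin (n + 1) → ℝ) :
    (choi (tensorPow (wernerHolevo d α) n) * symEffect d fun j => (d : ℝ) ^ n * x j).trace =
      (((d : ℝ) ^ n * lpObjective d n α x : ℝ) : ℂ) := by
  have e : choi (tensorPow (wernerHolevo d α) n) =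
      tens fun _ : Fin n => choi (wernerHolevo d α) :=
    choi_tensorProd fun _ => wernerHolevo d α
  rw [e, symEffect, Finset.mul_sum, Matrix.trace_sum, lpObjective_eq, Finset.mul_sum,
    Complex.ofReal_sum]
  refine Finset.sum_congr rfl fun s _ => ?_
  rw [Matrix.mul_smul, Matrix.trace_smul, trace_tens_mul_tens]
  simp only [trace_choi_wernerHolevo_mul_symProj hd, ← Complex.ofReal_prod,
    Finset.prod_mul_distrib, Finset.prod_const, Finset.card_univ, Fintype.card_fin, smul_eq_mul]
  rw [← Complex.ofReal_mul]
  congr 1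
  ring

theorem lpObjective_mem_achievableFidelities (hd : 2 ≤ d) {α : ℝ} (hK : 1 ≤ K) {ns ppt : Prop}
    {x : Fin (n + 1) → ℝ} (hx : x ∈ lpFeasible d n K ns ppt)
    (hxK : 2 ≤ K ∨ ∀ j, x j = ((d : ℝ) ^ n)⁻¹) :
    lpObjective d n α x ∈ achievableFidelities (tensorPow (wernerHolevo d α) n) K ns ppt := by
  have : NeZero d := ⟨by omega⟩
  have hD : (0 : ℝ) < (d : ℝ) ^ n := by have := NeZero.pos d; positivity
  have hK0 : (0 : ℝ) < K := by exact_mod_cast hK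
  obtain ⟨hb, hns, hppt⟩ := hx
  set z : Fin (n + 1) → ℝ := fun j => (d : ℝ) ^ n * x j with hz
  have h0 : (symEffect d z).PosSemidef :=
    symEffect_posSemidef fun j => mul_nonneg hD.le (hb j).1
  have h1 : (1 - symEffect d z).PosSemidef := by
    rw [← symEffect_one, ← symEffect_sub]
    refine symEffect_posSemidef fun j => sub_nonneg.mpr ?_
    have := mul_le_mul_of_nonneg_left (hb j).2 hD.le
    rwa [mul_inv_cancel₀ hD.ne'] at this
  have hL : 2 ≤ K ∨ symEffect d z = 1 := by
    refine hxK.imp_right fun h => ?_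
    rw [← symEffect_one]
    congr 1
    ext j
    simp only [hz, h, mul_inv_cancel₀ hD.ne']
  have hcard : (Fintype.card (Fin n → Fin d) : ℝ) = (d : ℝ) ^ n := by simp
  refine ⟨measurementCode (symEffect d z) h0 h1 hK hL, fun h => ?_, fun h => ?_, ?_⟩
  · refine measurementCode_nonSignalling h0 h1 hK hL fun f g => ?_
    rw [sum_symEffect]
    congr 1
    have e : ∑ j : Fin (n + 1), lpG d n j * z j = (d : ℝ) ^ n / (K : ℝ) ^ 2 := by
      simp only [hz, mul_left_comm _ ((d : ℝ) ^ n)]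
      rw [← Finset.mul_sum, hns h, mul_one_div]
    rw [e, ← hcard]
    push_cast
    rfl
  · have hM (i : Fin (n + 1)) : -(1 : ℝ) ≤ K * ∑ j : Fin (n + 1), lpM d n i j * z j ∧
        K * ∑ j : Fin (n + 1), lpM d n i j * z j ≤ 1 := by
      have e : K * ∑ j : Fin (n + 1), lpM d n i j * z j =
          (K * (d : ℝ) ^ n) * ∑ j : Fin (n + 1), lpM d n i j * x j := by
        simp only [hz, mul_left_comm _ ((d : ℝ) ^ n)]
        rw [← Finset.mul_sum]
        ring
      have e2 : (K * (d : ℝ) ^ n) * (((d : ℝ) ^ n)⁻¹ / K) = 1 := by field_simp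
      have l1 := mul_le_mul_of_nonneg_left (hppt h i).1 (by positivity : 0 ≤ K * (d : ℝ) ^ n)
      have l2 := mul_le_mul_of_nonneg_left (hppt h i).2 (by positivity : 0 ≤ K * (d : ℝ) ^ n)
      rw [mul_neg, e2] at l1
      rw [e2] at l2
      rw [e]
      exact ⟨l1, l2⟩
    refine measurementCode_pptPreserving h0 h1 hK hL ?_ ?_
    · have := one_add_ptranspose_symEffect_posSemidef (d := d) (z := z) (c := K)
        fun i => by linarith [(hM i).1]
      simpa using this
    · have := one_add_ptranspose_symEffect_posSemidef (d := d) (z := z) (c := -K)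
        fun i => by rw [neg_mul]; linarith [(hM i).2]
      simpa [sub_eq_add_neg] using this
  · rw [measurementCode_channelFidelity, trace_choi_mul_symEffect hd]
    have e : (Fintype.card (Fin n → Fin d) : ℂ)⁻¹ = ((((d : ℝ) ^ n)⁻¹ : ℝ) : ℂ) := by simp
    rw [e, ← Complex.ofReal_mul, Complex.ofReal_re, inv_mul_cancel_left₀ hD.ne']

end OptimalCode

/-! ### Feasibility, compactness and monotonicity of the linear program -/

section LinearProgram

variable {n d K : ℕ}

theorem sum_lpG (c : ℝ) : ∑ j : Fin (n + 1), lpG d n j * c = (d : ℝ) ^ n * c := by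
  rw [sum_lpG_eq d fun _ => c, ← Finset.sum_mul,
    sum_prod_eq_prod_sum fun (_ : Fin n) (b : Bool) =>
      if b then ((d : ℝ) - 1) / 2 else ((d : ℝ) + 1) / 2]
  simp only [Fintype.sum_bool, if_true, Bool.false_eq_true, if_false, Finset.prod_const,
    Finset.card_univ, Fintype.card_fin]
  congr 2
  ring

theorem sum_lpM (i : Fin (n + 1)) (c : ℝ) : ∑ j : Fin (n + 1), lpM d n i j * c = c := by
  obtain ⟨t, rfl⟩ := exists_weight_eq i
  rw [← sum_weight_mul_ptCoeff d fun _ => c, ← Finset.sum_mul,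
    sum_prod_eq_prod_sum fun (i : Fin n) b => ptCoeff d (t i) b]
  have h (b : Bool) : ∑ a, ptCoeff d b a = 1 := by
    cases b <;> simp only [Fintype.sum_bool, ptCoeff] <;> ring
  simp only [h, Finset.prod_const_one, one_mul]

/-- The weights $(d\pm1)/2$ sum to $d$ and the partial transpose coefficients to $1$, so a constant
point meets NS only at $d^{-n}/K^2$. For $K=1$ this is the upper corner of the box. -/
theorem const_mem_lpFeasible (hd : 2 ≤ d) (hK : 1 ≤ K) (ns ppt : Prop) :
    (fun _ => ((d : ℝ) ^ n)⁻¹ / (K : ℝ) ^ 2) ∈ lpFeasible d n K ns ppt := by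
  have hd0 : (0 : ℝ) < d := by exact_mod_cast (by omega : 0 < d)
  have hD : (0 : ℝ) < ((d : ℝ) ^ n)⁻¹ := by positivity
  have hK1 : (1 : ℝ) ≤ K := by exact_mod_cast hK
  refine ⟨fun _ => ⟨by positivity, div_le_self hD.le (by nlinarith)⟩, fun _ => ?_, fun _ i => ?_⟩
  · rw [sum_lpG]
    field_simp
  · rw [sum_lpM]
    have h : ((d : ℝ) ^ n)⁻¹ / (K : ℝ) ^ 2 ≤ ((d : ℝ) ^ n)⁻¹ / K :=
      div_le_div_of_nonneg_left hD.le (by linarith) (by nlinarith)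
    have h2 : 0 ≤ ((d : ℝ) ^ n)⁻¹ / (K : ℝ) ^ 2 := by positivity
    have h3 : 0 ≤ ((d : ℝ) ^ n)⁻¹ / K := by positivity
    exact ⟨by linarith, h⟩

theorem isCompact_lpFeasible (ns ppt : Prop) : IsCompact (lpFeasible d n K ns ppt) := by
  have h : lpFeasible d n K ns ppt =
      (Set.univ.pi fun _ => Set.Icc 0 ((d : ℝ) ^ n)⁻¹) ∩
        ({x | ns → ∑ j : Fin (n + 1), lpG d n j * x j = 1 / (K : ℝ) ^ 2} ∩
        {x | ppt → ∀ i : Fin (n + 1),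
          -(((d : ℝ) ^ n)⁻¹ / K) ≤ ∑ j : Fin (n + 1), lpM d n i j * x j ∧
            ∑ j : Fin (n + 1), lpM d n i j * x j ≤ ((d : ℝ) ^ n)⁻¹ / K}) := by
    ext x
    simp only [lpFeasible, Set.mem_inter_iff, Set.mem_pi, Set.mem_univ, forall_true_left,
      Set.mem_Icc, Set.mem_ofPred_eq]
  rw [h]
  refine (isCompact_univ_pi fun _ => isCompact_Icc).inter_right (IsClosed.inter ?_ ?_)
  · by_cases hns : ns
    · simp only [hns, forall_true_left]
      exact isClosed_eq (by fun_prop) continuous_const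
    · simp [hns]
  · by_cases hppt : ppt
    · simp only [hppt, forall_true_left, Set.ofPred_forall, Set.ofPred_and]
      exact isClosed_iInter fun i => (isClosed_le continuous_const (by fun_prop)).inter
        (isClosed_le (by fun_prop) continuous_const)
    · simp [hppt]

theorem lpObjective_mono (hd : 2 ≤ d) {α : ℝ} (hα₀ : 0 ≤ α) (hα₁ : α ≤ 1)
    {x y : Fin (n + 1) → ℝ} (h : ∀ j, x j ≤ y j) : lpObjective d n α x ≤ lpObjective d n α y := by
  have h1 : 0 ≤ 1 - α := by linarith
  refine mul_le_mul_of_nonneg_left (Finset.sum_le_sum fun j _ => ?_) (by positivity)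
  exact mul_le_mul_of_nonneg_left (h j) (by positivity)

end LinearProgram

end

end QCode

/-- For each of the four classes of codes (non-signalling and / or PPT-preserving, or neither), the
maximal channel fidelity of forward-assisted codes of size `K` for `n` uses of the generalised
Werner-Holevo channel and the maximum of the linear program exist and are equal. -/
theorem mainTheorem9 (d : ℕ) (hd : 2 ≤ d) (α : ℝ) (hα₀ : 0 ≤ α) (hα₁ : α ≤ 1)
    (n K : ℕ) (hK : 1 ≤ K) (ns ppt : Prop) :
    ∃ F : ℝ,
      IsGreatest
        (QCode.achievableFidelities (QCode.tensorPow (QCode.wernerHolevo d α) n) K ns ppt) F ∧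
      IsGreatest (QCode.lpObjective d n α '' QCode.lpFeasible d n K ns ppt) F := by
  have hsub := QCode.achievable_subset_lpObjective_image (n := n) hd (α := α) hK ns ppt
  have hconst := QCode.const_mem_lpFeasible (n := n) hd hK ns ppt
  obtain ⟨x, hx, hxK, hmax⟩ : ∃ x ∈ QCode.lpFeasible d n K ns ppt,
      (2 ≤ K ∨ ∀ j, x j = ((d : ℝ) ^ n)⁻¹) ∧ ∀ y ∈ QCode.lpFeasible d n K ns ppt,
        QCode.lpObjective d n α y ≤ QCode.lpObjective d n α x := by
    -- For $K\ge2$ any maximiser supplied by compactness will do. For $K=1$ the code needs $L=1$, so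
    -- the upper corner is taken; it is optimal by monotonicity.
    rcases hK.lt_or_eq with hK2 | rfl
    · have hcont : ContinuousOn (QCode.lpObjective d n α) (QCode.lpFeasible d n K ns ppt) := by
        unfold QCode.lpObjective
        fun_prop
      obtain ⟨x, hx, h⟩ := (QCode.isCompact_lpFeasible ns ppt).exists_isMaxOn ⟨_, hconst⟩ hcont
      exact ⟨x, hx, Or.inl hK2, h⟩
    · refine ⟨_, hconst, Or.inr fun j => by simp, fun y hy =>
        QCode.lpObjective_mono hd hα₀ hα₁ fun j => ?_⟩
      simpa using (hy.1 j).2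
  have hup : QCode.lpObjective d n α x ∈
      upperBounds (QCode.lpObjective d n α '' QCode.lpFeasible d n K ns ppt) := by
    rintro _ ⟨y, hy, rfl⟩
    exact hmax y hy
  exact ⟨QCode.lpObjective d n α x,
    ⟨QCode.lpObjective_mem_achievableFidelities hd hK hx hxK, fun f hf => hup (hsub hf)⟩,
    ⟨x, hx, rfl⟩, hup⟩
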